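/- Work with super ($\mathbb{Z}/2$-graded) vector spaces over a field $\mathbf{k}$ of characteristic $0$, with the Koszul sign rule. Let $V$ be a finite-dimensional super vector space with a nondegenerate odd symmetric scalar product $l:V\otimes V\to\Pi\mathbf{k}$. Let $F(V)=\bigoplus_{n\ge 0}F_n(V)$ with $F_n(V)=(V^{\otimes n}\otimes \mathbf{k}[\mathbb{S}_n])^{\mathbb{S}_n}$, where $\mathbb{S}_n$ acts on $\mathbf{k}[\mathbb{S}_n]$ by conjugation. By the cycle decomposition of permutations, $F(V)$ is the supersymmetric algebra generated by the cyclic words $(a_1\dots a_r)^c$, $r\ge 1$, $a_i\in V$. Let $\Delta:F_{n+2}(V)\to F_{n}(V)$ be the noncommutative Batalin--Vilkovisky operator: the sum over all unordered pairs of letters $x,y$ in a product of cyclic words of $\pm\, l(x,y)$ times the product of cyclic words in which $x$ and $y$ are removed and the cycles are cut and reglued there: $(AxB)^c(CyD)^c\mapsto(ADCB)^c$ if $x,y$ lie in different words, $(AxByC)^c\mapsto(AC)^c(B)^c$ if they lie in the same word. The signs are the Koszul signs, and terms with an empty cyclic word are $0$. Let $\{f,g\}=(-1)^{|f|}\bigl(\Delta(fg)-\Delta(f)g-(-1)^{|f|}f\Delta(g)\bigr)$.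 A solution of the noncommutative BV (quantum master) equation in $F(V)$ is an even $S\in F(V)[[\hbar]]$ with $\hbar\Delta S+\tfrac12\{S,S\}=0$. Let $W=\mathbf{k}^{k|\tilde k}$ with standard basis $(w_\beta)$, let $gl(k|\tilde k)=\mathrm{End}(W)$ with matrix units $E_{\beta\alpha}$ ($w_\alpha\mapsto w_\beta$), let $tr$ be the supertrace, and let $(\widetilde V,\tilde l)=(V,l)\otimes(gl(k|\tilde k),tr)$, that is, $\tilde l(a\otimes X,b\otimes Y)=(-1)^{|X||b|}\,l(a,b)\,tr(XY)$. **Theorem.** (1) There is exactly one unital algebra map $M:F(V)\to F(\widetilde V)$ which sends each cyclic word to the trace of the product of the corresponding matrices of generators, $$(a_1\dots a_r)^c\ \longmapsto\ tr(A_1\cdots A_r)^c=\sum_{\beta_1,\dots,\beta_r}\pm\bigl((a_1\otimes E_{\beta_1\beta_2})(a_2\otimes E_{\beta_2\beta_3})\cdots(a_r\otimes E_{\beta_r\beta_1})\bigr)^c ,\qquad r\ge 1,$$ for homogeneous $a_1,\dots,a_r\in V$, with the Koszul sign $(-1)^{|\beta_2|+\dots+|\beta_r|+\sum_t|a_t|(|\beta_1|+|\beta_t|)}$.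 (2) If $S$ is a solution of the noncommutative BV equation in $F(V)$, then $M(S)$ (with $M$ applied to each coefficient of $\hbar^a$) is a solution of the noncommutative BV equation in $F(\widetilde V)$. (3) A solution $T$ in $F(\widetilde V)$ is of the form $M(S)$ with a solution $S$ in $F(V)$ if and only if it has the following extra $gl(k|\tilde k)$-symmetry: for every $N$, the $gl(N|N)$-invariant function on $gl(N|N)\otimes\Pi\widetilde V=\bigl(gl(N|N)\otimes gl(k|\tilde k)\bigr)\otimes\Pi V$ that $T$ defines (each cyclic word being replaced by the supertrace of the product of the corresponding matrices) is invariant under the whole Lie superalgebra $gl(N|N)\otimes gl(k|\tilde k)=gl(\widetilde N|\widetilde N)$, $\widetilde N=N(k+\tilde k)$, and not only under $gl(N|N)$. -/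

import Mathlib

open scoped DirectSum

namespace NCBV

/-! ## Super vector spaces with a homogeneous basis

A finite dimensional super vector space over `𝕜` is given by the finite index type `ι` of a
homogeneous basis `(a_i)` and by the parities `p i : ZMod 2` of the basis vectors. -/

/-- The sign `(-1) ^ x` of a parity `x`. -/
def ksgn (𝕜 : Type*) [Field 𝕜] (x : ZMod 2) : 𝕜 := if x = 0 then 1 else -1

/-- The parity of the basis vectors of the super vector space `𝕜^{m|n}`. -/
def stdParity (m n : ℕ) : Fin m ⊕ Fin n → ZMod 2 := Sum.elim (fun _ => 0) (fun _ => 1)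

/-- Basis of the tensor product of two super vector spaces: parities add up. -/
def prodParity {κ υ : Type*} (q : κ → ZMod 2) (u : υ → ZMod 2) : κ × υ → ZMod 2 :=
  fun x => q x.1 + u x.2

/-- The basis `a_i ⊗ E_{β α}` of `V ⊗ End W`, indexed by `(i, β, α)`. Here `E_{β α}` is the matrix
unit with row `β` and column `α`, i.e. `E_{β α} w_α = w_β`; its parity is `|β| + |α|`. -/
def glParity {ι κ : Type*} (p : ι → ZMod 2) (q : κ → ZMod 2) : ι × κ × κ → ZMod 2 :=
  fun x => p x.1 + q x.2.1 + q x.2.2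

/-- A (nondegenerate) odd symmetric scalar product `l : V ⊗ V → Π𝕜`, with
`form i j = l (a_i, a_j)`. -/
structure OddScalarProduct (𝕜 : Type*) [Field 𝕜] {ι : Type*} [Fintype ι] (p : ι → ZMod 2) where
  form : ι → ι → 𝕜
  odd : ∀ i j, form i j ≠ 0 → p i + p j = 1
  symm : ∀ i j, form i j = ksgn 𝕜 (p i * p j) * form j i
  nondeg : ∀ x : ι → 𝕜, (∀ j, ∑ i, x i * form i j = 0) → x = 0

/-- The supertrace pairing `tr (E_{β α} E_{δ γ})` on `End W`. -/
def strForm (𝕜 : Type*) [Field 𝕜] {κ : Type*} [DecidableEq κ] (q : κ → ZMod 2)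
    (x y : κ × κ) : 𝕜 :=
  if x.2 = y.1 ∧ x.1 = y.2 then ksgn 𝕜 (q x.1) else 0

lemma ksgn_ne_zero (𝕜 : Type*) [Field 𝕜] (x : ZMod 2) : ksgn 𝕜 x ≠ 0 := by
  unfold ksgn; split_ifs <;> simp

lemma ksgn_add (𝕜 : Type*) [Field 𝕜] (x y : ZMod 2) :
    ksgn 𝕜 (x + y) = ksgn 𝕜 x * ksgn 𝕜 y := by
  have h : ∀ z : ZMod 2, z = 0 ∨ z = 1 := by decide
  rcases h x with rfl | rfl <;> rcases h y with rfl | rfl <;>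
    simp [ksgn, show (1 : ZMod 2) + 1 = 0 from by decide]

/-- The odd scalar product `(V, l) ⊗ (End W, tr)`:
`(a ⊗ X, b ⊗ Y) ↦ (-1)^{|X| |b|} l (a, b) tr (X Y)`. -/
def OddScalarProduct.tensorGl {𝕜 : Type*} [Field 𝕜] {ι κ : Type*} [Fintype ι] [Fintype κ]
    [DecidableEq κ] {p : ι → ZMod 2} (l : OddScalarProduct 𝕜 p) (q : κ → ZMod 2) :
    OddScalarProduct 𝕜 (glParity p q) where
  form x y := ksgn 𝕜 ((q x.2.1 + q x.2.2) * p y.1) * l.form x.1 y.1 * strForm 𝕜 q x.2 y.2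
  odd := by
    rintro ⟨i, β, α⟩ ⟨j, δ, γ⟩ h
    simp only [strForm] at h
    split_ifs at h with hc
    · obtain ⟨h1, h2⟩ := hc
      subst h1 h2
      have hl : l.form i j ≠ 0 := by
        intro h0; simp [h0] at h
      have key : ∀ a b c d : ZMod 2, a + b = 1 → a + c + d + (b + d + c) = 1 := by decide
      exact key _ _ _ _ (l.odd i j hl)
    · simp at h
  symm := by
    rintro ⟨i, β, α⟩ ⟨j, δ, γ⟩
    simp only [strForm, glParity]
    by_cases hc : α = δ ∧ β = γ
    · obtain ⟨rfl, rfl⟩ := hc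
      by_cases hl : l.form i j = 0
      · have : l.form j i = 0 := by
          have := l.symm i j
          rw [hl] at this
          rcases mul_eq_zero.1 this.symm with h | h
          · exact absurd h (ksgn_ne_zero 𝕜 _)
          · exact h
        simp [hl, this]
      · have ho := l.odd i j hl
        rw [l.symm i j]
        simp only [and_self, if_true]
        have key : ∀ a b c d : ZMod 2, a + b = 1 →
            (c + d) * b + a * b + c
              = (a + c + d) * (b + d + c) + (d + c) * a + d := by decide
        have := congrArg (ksgn 𝕜) (key _ _ (q β) (q α) ho)
        simp only [ksgn_add] at this
        linear_combination (l.form j i) * this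
    · have hc' : ¬ (γ = β ∧ δ = α) := fun h => hc ⟨h.2.symm, h.1.symm⟩
      simp [hc, hc']
  nondeg := by
    intro x hx
    funext ⟨i, β, α⟩
    have := l.nondeg (fun i => ksgn 𝕜 ((q β + q α) * (p i + 1)) * x (i, β, α)) (by
      intro j
      have h := hx (j, α, β)
      rw [Fintype.sum_prod_type] at h
      have h2 : ∀ i, ∑ y : κ × κ, x (i, y) * (ksgn 𝕜 ((q y.1 + q y.2) * p j) * l.form i j *
          strForm 𝕜 q y (α, β))
          = ksgn 𝕜 (q β) * (ksgn 𝕜 ((q β + q α) * (p i + 1)) * x (i, β, α) * l.form i j) := by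
        intro i
        rw [Finset.sum_eq_single (β, α)]
        · simp only [strForm, and_self, if_true]
          by_cases hl : l.form i j = 0
          · simp [hl]
          · have ho := l.odd i j hl
            have : p i + 1 = p j := by
              revert ho; generalize p i = a; generalize p j = b; revert a b; decide
            rw [this]; ring
        · rintro ⟨b, a⟩ - hne
          have : ¬ (a = α ∧ b = β) := fun h => hne (by rw [h.1, h.2])
          simp [strForm, this]
        · simp
      rw [Finset.sum_congr rfl (fun i _ => h2 i), ← Finset.mul_sum] at h
      exact (mul_eq_zero.1 h).resolve_left (ksgn_ne_zero 𝕜 _))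
    have h3 := congrFun this i
    exact (mul_eq_zero.1 h3).resolve_left (ksgn_ne_zero 𝕜 _)

/-! ## The space `F(V) = ⨁ₙ (V^{⊗ n} ⊗ 𝕜[Sₙ])^{Sₙ}` -/

/-- The space `V^{⊗ n} ⊗ 𝕜[Sₙ]`; the coefficient of `a_{i 0} ⊗ ⋯ ⊗ a_{i (n-1)} ⊗ σ` in `c`
is `c i σ`. -/
abbrev Tens (𝕜 : Type*) (ι : Type*) (n : ℕ) : Type _ :=
  (Fin n → ι) → Equiv.Perm (Fin n) → 𝕜

/-- The Koszul sign of the permutation `τ` (which moves the `s`-th factor to the place `τ s`)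
applied to the tensor `a_{i 0} ⊗ ⋯ ⊗ a_{i (n-1)}`. -/
def koszul (𝕜 : Type*) [Field 𝕜] {ι : Type*} (p : ι → ZMod 2) {n : ℕ}
    (τ : Equiv.Perm (Fin n)) (i : Fin n → ι) : 𝕜 :=
  ∏ s, ∏ t, if s < t ∧ τ t < τ s then ksgn 𝕜 (p (i s) * p (i t)) else 1

section action

variable (𝕜 : Type*) [Field 𝕜] {ι : Type*} (p : ι → ZMod 2) {n : ℕ}

/-- The action of `Sₙ` on `V^{⊗ n} ⊗ 𝕜[Sₙ]`: permutation of the factors (with Koszul sign) on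
`V^{⊗ n}`, conjugation on `𝕜[Sₙ]`. -/
def act (τ : Equiv.Perm (Fin n)) : Tens 𝕜 ι n →ₗ[𝕜] Tens 𝕜 ι n where
  toFun c := fun i σ => koszul 𝕜 p τ (i ∘ τ) * c (i ∘ τ) (τ⁻¹ * σ * τ)
  map_add' c d := by funext i σ; simp [mul_add]
  map_smul' r c := by funext i σ; simp [mul_left_comm]

/-- `F_n(V) = (V^{⊗ n} ⊗ 𝕜[Sₙ])^{Sₙ}`. -/
def Fn (n : ℕ) : Submodule 𝕜 (Tens 𝕜 ι n) where
  carrier := {c | ∀ τ : Equiv.Perm (Fin n), act 𝕜 p τ c = c}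
  add_mem' hc hd τ := by rw [map_add, hc τ, hd τ]
  zero_mem' τ := map_zero _
  smul_mem' r c hc τ := by rw [map_smul, hc τ]



end action

/-- A symmetric function has the same product over the pairs that are increasing for `<` and over
the pairs that are increasing after a permutation. -/
lemma prod_lt_perm {M : Type*} [CommMonoid M] {n : ℕ} (τ : Equiv.Perm (Fin n))
    (f : Fin n → Fin n → M) (hf : ∀ s t, f s t = f t s) :
    (∏ s, ∏ t, if s < t then f s t else 1) = ∏ s, ∏ t, if τ s < τ t then f s t else 1 := by
  have h1 : ∀ s t, (if s < t then f s t else 1)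
      = (if s < t ∧ τ s < τ t then f s t else 1) * (if s < t ∧ τ t < τ s then f s t else 1) := by
    intro s t
    by_cases h : s < t
    · have hne : τ s ≠ τ t := fun e => h.ne (τ.injective e)
      rcases lt_or_gt_of_ne hne with h' | h'
      · simp [h, h', h'.not_gt]
      · simp [h, h', h'.not_gt]
    · simp [h]
  have h2 : ∀ s t, (if τ s < τ t then f s t else 1)
      = (if s < t ∧ τ s < τ t then f s t else 1) * (if t < s ∧ τ s < τ t then f t s else 1) := by
    intro s t
    by_cases h : τ s < τ t
    · have hne : s ≠ t := fun e => h.ne (by rw [e])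
      rcases lt_or_gt_of_ne hne with h' | h'
      · simp [h, h', h'.not_gt]
      · simp [h, h', h'.not_gt, hf s t]
    · simp [h]
  simp_rw [h1, h2, Finset.prod_mul_distrib]
  congr 1
  exact Finset.prod_comm

/-- The Koszul signs form a cocycle. -/
lemma koszul_mul (𝕜 : Type*) [Field 𝕜] {ι : Type*} (p : ι → ZMod 2) {n : ℕ}
    (τ ρ : Equiv.Perm (Fin n)) (i : Fin n → ι) :
    koszul 𝕜 p (τ * ρ) (i ∘ ⇑(τ * ρ)) = koszul 𝕜 p τ (i ∘ τ) * koszul 𝕜 p ρ (i ∘ τ ∘ ρ) := by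
  set f : Fin n → Fin n → 𝕜 := fun s t => ksgn 𝕜 (p (i (τ (ρ s))) * p (i (τ (ρ t)))) with hf
  have hsymm : ∀ s t, f s t = f t s := fun s t => by simp only [hf, mul_comm]
  have hsq : ∀ s t, f s t * f s t = 1 := fun s t => by
    simp only [hf, ksgn]; split_ifs <;> simp
  -- rewrite the sign of `τ` as a product over pairs of indices before `ρ`
  have e1 : koszul 𝕜 p τ (i ∘ τ)
      = ∏ s, ∏ t, if s < t ∧ (ρ s < ρ t ↔ τ (ρ t) < τ (ρ s)) then f s t else 1 := by
    have a1 : koszul 𝕜 p τ (i ∘ τ)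
        = ∏ s, ∏ t, if ρ s < ρ t then (if τ (ρ t) < τ (ρ s) ∧ ρ s < ρ t ∨
            τ (ρ s) < τ (ρ t) ∧ ρ t < ρ s then f s t else 1) else 1 := by
      unfold koszul
      rw [← Equiv.prod_comp ρ]
      refine Finset.prod_congr rfl fun s _ => ?_
      rw [← Equiv.prod_comp ρ]
      refine Finset.prod_congr rfl fun t _ => ?_
      by_cases h : ρ s < ρ t
      · simp [h, h.not_gt, hf]
      · simp [h]
    rw [a1, ← prod_lt_perm ρ]
    · refine Finset.prod_congr rfl fun s _ => Finset.prod_congr rfl fun t _ => ?_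
      by_cases h : s < t
      · have hne : ρ s ≠ ρ t := fun e => h.ne (ρ.injective e)
        have hne' : τ (ρ s) ≠ τ (ρ t) := fun e => hne (τ.injective e)
        rcases lt_or_gt_of_ne hne with h' | h' <;> rcases lt_or_gt_of_ne hne' with h'' | h'' <;>
          simp [h, h', h'', h'.not_gt, h''.not_gt]
      · simp [h]
    · intro s t
      rw [hsymm s t]
      congr 1
      exact propext or_comm
  rw [e1]
  unfold koszul
  simp_rw [← Finset.prod_mul_distrib]
  refine Finset.prod_congr rfl fun s _ => Finset.prod_congr rfl fun t _ => ?_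
  by_cases h : s < t
  · have hne : ρ s ≠ ρ t := fun e => h.ne (ρ.injective e)
    have hne' : τ (ρ s) ≠ τ (ρ t) := fun e => hne (τ.injective e)
    have := hsq s t
    simp only [hf] at this
    rcases lt_or_gt_of_ne hne with h' | h' <;> rcases lt_or_gt_of_ne hne' with h'' | h'' <;>
      simp [h, h', h'', h'.not_gt, h''.not_gt, hf, this]
  · simp [h]

section spaces

variable (𝕜 : Type*) [Field 𝕜] {ι : Type*} (p : ι → ZMod 2)

lemma act_act {n : ℕ} (τ ρ : Equiv.Perm (Fin n)) (c : Tens 𝕜 ι n) :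
    act 𝕜 p τ (act 𝕜 p ρ c) = act 𝕜 p (τ * ρ) c := by
  funext i σ
  have := koszul_mul 𝕜 p τ ρ i
  simp only [act, LinearMap.coe_mk, AddHom.coe_mk]
  rw [this, mul_assoc]
  simp only [mul_assoc, mul_inv_rev, Equiv.Perm.coe_mul, Function.comp_assoc]

/-- The averaging projection of `V^{⊗ n} ⊗ 𝕜[Sₙ]` onto its subspace `F_n(V)` of invariants; it
realizes the canonical isomorphism of coinvariants with invariants. -/
def avg (n : ℕ) : Tens 𝕜 ι n →ₗ[𝕜] Fn 𝕜 p n :=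
  LinearMap.codRestrict (Fn 𝕜 p n)
    ((n.factorial : 𝕜)⁻¹ • ∑ τ : Equiv.Perm (Fin n), act 𝕜 p τ)
    (by
      intro c τ
      simp only [LinearMap.smul_apply, LinearMap.sum_apply, map_smul, map_sum, act_act]
      congr 1
      exact Equiv.sum_comp (Equiv.mulLeft τ) (fun ρ => act 𝕜 p ρ c))

/-- The space `F(V) = ⨁ₙ F_n(V)`. -/
abbrev F : Type _ := ⨁ n : ℕ, Fn 𝕜 p n

/-- The inclusion `F_n(V) → F(V)`. -/
def ofFn (n : ℕ) : Fn 𝕜 p n →ₗ[𝕜] F 𝕜 p := DirectSum.lof 𝕜 ℕ (fun n => Fn 𝕜 p n) n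

/-- The permutation of `{0, …, m + n - 1}` that acts by `σ` on the first `m` and by `σ'` on the last
`n` elements. -/
def blockPerm {m n : ℕ} (σ : Equiv.Perm (Fin m)) (σ' : Equiv.Perm (Fin n)) :
    Equiv.Perm (Fin (m + n)) :=
  finSumFinEquiv.permCongr (Equiv.sumCongr σ σ')

/-- The juxtaposition `(v ⊗ σ, v' ⊗ σ') ↦ (v ⊗ v') ⊗ (σ ⊔ σ')`. -/
def juxt {m n : ℕ} : Tens 𝕜 ι m →ₗ[𝕜] Tens 𝕜 ι n →ₗ[𝕜] Tens 𝕜 ι (m + n) :=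
  LinearMap.mk₂ 𝕜
    (fun f g i σ => ∑ σ₁ : Equiv.Perm (Fin m), ∑ σ₂ : Equiv.Perm (Fin n),
      if blockPerm σ₁ σ₂ = σ then f (i ∘ Fin.castAdd n) σ₁ * g (i ∘ Fin.natAdd m) σ₂ else 0)
    (by
      intro f f' g; funext i σ
      simp only [Pi.add_apply, ← Finset.sum_add_distrib]
      refine Finset.sum_congr rfl fun _ _ => Finset.sum_congr rfl fun _ _ => ?_
      split_ifs <;> ring)
    (by
      intro r f g; funext i σ
      simp only [Pi.smul_apply, smul_eq_mul, Finset.mul_sum]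
      refine Finset.sum_congr rfl fun _ _ => Finset.sum_congr rfl fun _ _ => ?_
      split_ifs <;> ring)
    (by
      intro f g g'; funext i σ
      simp only [Pi.add_apply, ← Finset.sum_add_distrib]
      refine Finset.sum_congr rfl fun _ _ => Finset.sum_congr rfl fun _ _ => ?_
      split_ifs <;> ring)
    (by
      intro r f g; funext i σ
      simp only [Pi.smul_apply, smul_eq_mul, Finset.mul_sum]
      refine Finset.sum_congr rfl fun _ _ => Finset.sum_congr rfl fun _ _ => ?_
      split_ifs <;> ring)

/-- The product of `F(V)`, i.e. that of the symmetric algebra of the space of cyclic words. -/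
noncomputable def mul : F 𝕜 p →ₗ[𝕜] F 𝕜 p →ₗ[𝕜] F 𝕜 p :=
  DirectSum.toModule 𝕜 ℕ _ fun m => LinearMap.flip <| DirectSum.toModule 𝕜 ℕ _ fun n =>
    LinearMap.flip <|
      ((juxt 𝕜).domRestrict₁₂ (Fn 𝕜 p m) (Fn 𝕜 p n)).compr₂ (ofFn 𝕜 p (m + n) ∘ₗ avg 𝕜 p (m + n))

/-- The unit of `F(V)`. -/
noncomputable def one : F 𝕜 p := ofFn 𝕜 p 0 (avg 𝕜 p 0 fun _ _ => 1)

/-- The cyclic word `(a_{w 0} a_{w 1} ⋯ a_{w (r-1)})^c`, for `r ≥ 1`: the class of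
`a_{w 0} ⊗ ⋯ ⊗ a_{w (r-1)} ⊗ (0 1 ⋯ r-1)`. -/
noncomputable def cyc [DecidableEq ι] {r : ℕ} (w : Fin r → ι) : F 𝕜 p :=
  ofFn 𝕜 p r (avg 𝕜 p r (fun i σ => if i = w ∧ σ = finRotate r then 1 else 0))

/-- The parity operator `f ↦ (-1)^{|f|} f` of `F(V)`. -/
noncomputable def parityOp : F 𝕜 p →ₗ[𝕜] F 𝕜 p :=
  DirectSum.toModule 𝕜 ℕ _ fun n => ofFn 𝕜 p n ∘ₗ avg 𝕜 p n ∘ₗ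
    { toFun := fun c i σ => ksgn 𝕜 (∑ s, p (i s)) * c.1 i σ
      map_add' := by intro c d; funext i σ; simp [mul_add]
      map_smul' := by intro r c; funext i σ; simp [mul_left_comm] }

/-- Even elements of `F(V)`: only monomials of total parity `0` occur. -/
def IsEven (f : F 𝕜 p) : Prop :=
  ∀ (n : ℕ) (i : Fin n → ι) (σ : Equiv.Perm (Fin n)), (f n).1 i σ ≠ 0 → ∑ s, p (i s) = 0

end spaces

/-! ## The Batalin-Vilkovisky operator -/

/-- The result of dissecting-gluing the cycles of `σ` at `0` and `1`. If `0` and `1` lie on the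
two cycles `(A 0 B)` and `(C 1 D)`, these are replaced by `(A D C B)`; if they lie on one cycle
`(A 0 B 1 C)`, it is replaced by `(A C)(B)`. That is to say, `σ` is multiplied by the
transposition of `0` and `1`, and then `0` and `1` are erased from their cycles. -/
def cutGlue {n : ℕ} (σ : Equiv.Perm (Fin (n + 2))) : Equiv.Perm (Fin n) :=
  (Equiv.Perm.decomposeFin (Equiv.Perm.decomposeFin (σ * Equiv.swap 0 1)).2).2

/-- The dissection-gluing of `σ` at `0` and `1` produces an empty cycle: `0` and `1` are adjacent
on a common cycle, or are both fixed. -/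
def HasEmptyCycle {n : ℕ} (σ : Equiv.Perm (Fin (n + 2))) : Prop :=
  σ 0 = 1 ∨ σ 1 = 0 ∨ (σ 0 = 0 ∧ σ 1 = 1)

instance {n : ℕ} (σ : Equiv.Perm (Fin (n + 2))) : Decidable (HasEmptyCycle σ) := by
  unfold HasEmptyCycle; infer_instance

section BV

variable {𝕜 : Type*} [Field 𝕜] {ι : Type*} [Fintype ι] {p : ι → ZMod 2}

/-- The contraction of the first two letters by `l` together with the dissection-gluing of the
cycles at these letters. Terms with an empty cyclic word are zero. -/
def contract (l : OddScalarProduct 𝕜 p) (n : ℕ) : Tens 𝕜 ι (n + 2) →ₗ[𝕜] Tens 𝕜 ι n where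
  toFun c := fun v τ => ∑ x, ∑ y, ∑ σ : Equiv.Perm (Fin (n + 2)),
    if ¬ HasEmptyCycle σ ∧ cutGlue σ = τ then
      l.form x y * c (Fin.cons x (Fin.cons y v)) σ else 0
  map_add' c d := by
    funext v τ
    simp only [Pi.add_apply, ← Finset.sum_add_distrib]
    refine Finset.sum_congr rfl fun _ _ => Finset.sum_congr rfl fun _ _ =>
      Finset.sum_congr rfl fun _ _ => ?_
    split_ifs <;> ring
  map_smul' r c := by
    funext v τ
    simp only [Pi.smul_apply, smul_eq_mul, Finset.mul_sum, RingHom.id_apply]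
    refine Finset.sum_congr rfl fun _ _ => Finset.sum_congr rfl fun _ _ =>
      Finset.sum_congr rfl fun _ _ => ?_
    split_ifs <;> ring

/-- The noncommutative Batalin-Vilkovisky operator `Δ : F(V) → F(V)`: the sum over all unordered
pairs of letters of the contractions with dissection-gluing. On an invariant tensor each of the
`(n + 2)(n + 1)/2` pairs contributes as much as the pair of the first two letters. -/
noncomputable def Delta (l : OddScalarProduct 𝕜 p) : F 𝕜 p →ₗ[𝕜] F 𝕜 p :=
  DirectSum.toModule 𝕜 ℕ _ fun n => match n with
    | 0 => 0
    | 1 => 0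
    | n + 2 => ((n + 2).choose 2 : 𝕜) •
        (ofFn 𝕜 p n ∘ₗ avg 𝕜 p n ∘ₗ contract l n ∘ₗ (Fn 𝕜 p (n + 2)).subtype)

/-- The odd symplectic bracket of `F(V)`:
`{f, g} = (-1)^{|f|} (Δ(f g) - Δ(f) g - (-1)^{|f|} f Δ(g))`. -/
noncomputable def bracket (l : OddScalarProduct 𝕜 p) (f g : F 𝕜 p) : F 𝕜 p :=
  Delta l (mul 𝕜 p (parityOp 𝕜 p f) g) - mul 𝕜 p (Delta l (parityOp 𝕜 p f)) g
    - mul 𝕜 p f (Delta l g)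

/-- The coefficient of `ħ ^ m` in `ħ Δ S`, for `S = ∑ ħ ^ a S_a`. -/
noncomputable def hbarDelta (l : OddScalarProduct 𝕜 p) (S : ℕ → F 𝕜 p) : ℕ → F 𝕜 p
  | 0 => 0
  | m + 1 => Delta l (S m)

/-- `S = ∑ ħ ^ a S_a ∈ F(V)[[ħ]]` is a solution of the noncommutative Batalin-Vilkovisky (quantum
master) equation: `S` is even and `ħ Δ S + {S, S} / 2 = 0`. -/
def IsSolution (l : OddScalarProduct 𝕜 p) (S : ℕ → F 𝕜 p) : Prop :=
  (∀ a, IsEven 𝕜 p (S a)) ∧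
  ∀ m, hbarDelta l S m
    + (2 : 𝕜)⁻¹ • ∑ ab ∈ Finset.HasAntidiagonal.antidiagonal m, bracket l (S ab.1) (S ab.2) = 0

end BV

/-! ## The trace map and the extra symmetry -/

section trace

variable {𝕜 : Type*} [Field 𝕜] {ι κ : Type*} [DecidableEq ι] [Fintype κ] [DecidableEq κ]
  {p : ι → ZMod 2} {q : κ → ZMod 2}

/-- The cyclic word `tr (A_{w 0} A_{w 1} ⋯ A_{w r})^c` in the letters of `V ⊗ End W`, where `A_i` is
the matrix with the entries `a_i ⊗ E_{β α}`: the sum over all `β` of the cyclic words in the letters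
`a_{w t} ⊗ E_{β t, β (t + 1)}` with `t + 1` taken modulo `r + 1`. The Koszul sign is the
product of `(-1)^{|β 1| + ⋯ + |β r|}`, the sign of the cyclic permutation of tensors as an element
of `End(W)^{⊗ (r + 1)}`, and of the sign of moving each matrix unit past the letters of `w`
to its right. -/
noncomputable def traceWord {r : ℕ} (w : Fin (r + 1) → ι) : F 𝕜 (glParity p q) :=
  ∑ β : Fin (r + 1) → κ,
    ksgn 𝕜 (∑ t : Fin r, q (β t.succ) + ∑ t, p (w t) * (q (β 0) + q (β t))) •
      cyc 𝕜 (glParity p q) (fun t => (w t, β t, β (t + 1)))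

/-- `M` is the map of algebras `F(V) → F(V ⊗ End W)` with
`(a_{w 0} ⋯ a_{w r})^c ↦ tr (A_{w 0} ⋯ A_{w r})^c`. -/
def IsTraceMap (M : F 𝕜 p →ₗ[𝕜] F 𝕜 (glParity p q)) : Prop :=
  M (one 𝕜 p) = one 𝕜 (glParity p q) ∧
  (∀ f g, M (mul 𝕜 p f g) = mul 𝕜 (glParity p q) (M f) (M g)) ∧
  ∀ (r : ℕ) (w : Fin (r + 1) → ι), M (cyc 𝕜 p w) = traceWord w

end trace

section symmetry

variable {𝕜 : Type*} [Field 𝕜] {ι κ υ : Type*} {p : ι → ZMod 2}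

/-- The coefficient of `x = (a_{i 0} ⊗ E_{β 0, α 0}) ⊗ ⋯ ⊗ (a_{i (n-1)} ⊗ E_{β (n-1), α (n-1)})` in
the image of `a_{i 0} ⊗ ⋯ ⊗ a_{i (n-1)} ⊗ μ(σ)` under
`V^{⊗ n} ⊗ End(U)^{⊗ n} ≅ (V ⊗ End U)^{⊗ n}`. Here
`μ(σ) ∈ End(U^{⊗ n}) ≅ End(U)^{⊗ n}` is the permutation of tensors by `σ`. The three factors
are the Koszul signs of the permutation of `u_{α 0} ⊗ ⋯ ⊗ u_{α (n-1)}`, of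
`End(U)^{⊗ n} ≅ End(U^{⊗ n})` and of the reordering of the `a_{i s}` and the matrix units. -/
def muCoeff (𝕜 : Type*) [Field 𝕜] [DecidableEq υ] (p : ι → ZMod 2) (u : υ → ZMod 2) {n : ℕ}
    (σ : Equiv.Perm (Fin n)) (x : Fin n → ι × υ × υ) : 𝕜 :=
  if ∀ s, (x s).2.1 = (x (σ⁻¹ s)).2.2 then
    koszul 𝕜 u σ (fun s => (x s).2.2)
      * (∏ s, ∏ t, if s < t then ksgn 𝕜 ((u (x t).2.1 + u (x t).2.2) * u (x s).2.2) else 1)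
      * (∏ s, ∏ t, if s < t then ksgn 𝕜 ((u (x s).2.1 + u (x s).2.2) * p (x t).1) else 1)
  else 0

/-- The `GL(U)`-invariant function on `End(U) ⊗ ΠV` that corresponds to an element of `F_n(V)`,
written as a symmetric tensor in `(V ⊗ End U)^{⊗ n}`. -/
def muF [DecidableEq υ] (u : υ → ZMod 2) {n : ℕ} (c : Fn 𝕜 p n) : (Fin n → ι × υ × υ) → 𝕜 :=
  fun x => ∑ σ : Equiv.Perm (Fin n), c.1 (fun s => (x s).1) σ * muCoeff 𝕜 p u σ x

/-- The identification `((V ⊗ End W) ⊗ End U)^{⊗ n} ≅ (V ⊗ End(W ⊗ U))^{⊗ n}` given by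
`E_{β α} ⊗ E_{δ γ} ↦ (-1)^{(|δ| + |γ|) |α|} E_{(β, δ), (α, γ)}`. -/
def regroup (q : κ → ZMod 2) (u : υ → ZMod 2) {n : ℕ}
    (d : (Fin n → (ι × κ × κ) × υ × υ) → 𝕜) : (Fin n → ι × (κ × υ) × (κ × υ)) → 𝕜 :=
  fun x => (∏ s, ksgn 𝕜 ((u (x s).2.1.2 + u (x s).2.2.2) * q (x s).2.2.1)) *
    d (fun s => (((x s).1, (x s).2.1.1, (x s).2.2.1), (x s).2.1.2, (x s).2.2.2))

/-- The action on `(V ⊗ End W)^{⊗ n}` of a matrix `G ∈ gl(W)` of parity `g`, by the derivation that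
extends `a ⊗ X ↦ (-1)^{g |a|} a ⊗ (G X - (-1)^{g |X|} X G)`. -/
def glAct [Fintype κ] (p : ι → ZMod 2) (q : κ → ZMod 2) (g : ZMod 2) (G : Matrix κ κ 𝕜) {n : ℕ}
    (d : (Fin n → ι × κ × κ) → 𝕜) : (Fin n → ι × κ × κ) → 𝕜 :=
  fun x => ∑ s : Fin n,
    ksgn 𝕜 (g * ((∑ t : Fin n, if t < s then glParity p q (x t) else 0) + p (x s).1)) *
      ∑ γ : κ,
        (G (x s).2.1 γ * d (Function.update x s ((x s).1, γ, (x s).2.2))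
          - ksgn 𝕜 (g * (q (x s).2.1 + q γ)) *
              (d (Function.update x s ((x s).1, (x s).2.1, γ)) * G γ (x s).2.2))

/-- A tensor in `(V ⊗ End W)^{⊗ n}` is invariant under the Lie superalgebra `gl(W)`. -/
def IsGlInvariant [Fintype κ] (p : ι → ZMod 2) (q : κ → ZMod 2) {n : ℕ}
    (d : (Fin n → ι × κ × κ) → 𝕜) : Prop :=
  ∀ (g : ZMod 2) (G : Matrix κ κ 𝕜), (∀ β α, G β α ≠ 0 → q β + q α = g) → glAct p q g G d = 0

/-- The extra symmetry of an element of `F(V ⊗ End W)`: for all `N`, and `U = 𝕜^{N|N}`, the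
`gl(N|N)`-invariant function that it defines on
`gl(N|N) ⊗ Π(V ⊗ End W) = (gl(N|N) ⊗ End W) ⊗ ΠV` is invariant under all of
`gl(N|N) ⊗ End W = gl(W ⊗ U)`. -/
def HasExtraSymmetry [Fintype κ] [DecidableEq κ] {q : κ → ZMod 2}
    (f : F 𝕜 (glParity p q)) : Prop :=
  ∀ N n : ℕ, IsGlInvariant p (prodParity q (stdParity N N))
    (regroup q (stdParity N N) (muF (stdParity N N) (f n)))

end symmetry

end NCBV

/-!
# The trace map of the noncommutative Batalin-Vilkovisky algebra

On `V^{⊗ n} ⊗ 𝕜[Sₙ]` the trace map is `v ⊗ σ ↦ (v ⊗ μ(σ)) ⊗ σ` (`traceTens`), where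
`μ(σ) ∈ End(W)^{⊗ n}` is the permutation of tensors by `σ`, with the coefficients `muCoeff`. This
formula is equivariant, multiplicative for juxtaposition, and on a single cycle it is the trace of a
product of matrices. As every permutation is a product of cycles, `F(V)` is generated by the
cyclic words (`ext_of_cyc`), so that the trace map is the only algebra map with these values.

It commutes with `Delta` (`contract_traceTens`): in `μ(σ)`, contracting two matrix units by the
supertrace identifies the four indices crosswise, which is the dissection-gluing of the cycles of
`σ`, and the two indices at the cut are determined by the other ones because no empty cycle is
produced (`sum_muCoeff_cons`). Hence it commutes with the bracket and maps solutions to solutions.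
For `W ≠ 0` it is injective, so that a preimage of a solution is again a solution; for `W = 0` all
of `F(V ⊗ End W)` is constant, and constants are solutions.

The extra symmetry of `M(S)` holds because `μ(σ)` for `W ⊗ U` is the tensor product of those for
`W` and for `U` (`regroup_muTens_traceTens`) and `μ(σ)` is `gl`-invariant
(`isGlInvariant_muTens`). For the converse, let `T` have components `T(σ) ∈ (V ⊗ End W)^{⊗ n}`, and
let `U` have an even part of dimension `n + 1`. Applying `∑ T(σ) ⊗ μ(σ)` to `n` distinct even basis
vectors of `U` separates the permutations `σ`. Commutation with `X ⊗ Y`, where `X` is a matrix unit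
of `W` and `Y` replaces one of these vectors by the remaining one, then says that `T(σ) μ(σ)⁻¹`
commutes with `X` acting on one tensor factor (`exists_relation`). So `T(σ)` is a multiple of
`μ(σ)` (`exists_traceTens_eq`), without recourse to the fundamental theorem of invariant theory.

All signs are exponents in `ZMod 2`, expressed by the bilinear form `bil` over the pairs `s < t` and
the form `inv` over the inversions of a permutation. They are related by `bil_perm`, from which,
with `bil_swap` and the cocycle property `inv_mul`, the sign identities follow.
-/

namespace NCBV

/-! ### Signs -/

lemma ksgn_zero (𝕜 : Type*) [Field 𝕜] : ksgn 𝕜 0 = 1 := by simp [ksgn]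

lemma ksgn_sum (𝕜 : Type*) [Field 𝕜] {α : Type*} (S : Finset α) (f : α → ZMod 2) :
    ksgn 𝕜 (∑ a ∈ S, f a) = ∏ a ∈ S, ksgn 𝕜 (f a) := by
  classical
  induction S using Finset.induction_on with
  | empty => simp [ksgn_zero]
  | insert a S ha ih => rw [Finset.sum_insert ha, Finset.prod_insert ha, ksgn_add, ih]

lemma ksgn_ite (𝕜 : Type*) [Field 𝕜] (P : Prop) [Decidable P] (x : ZMod 2) :
    ksgn 𝕜 (if P then x else 0) = if P then ksgn 𝕜 x else 1 := by
  split_ifs <;> simp [ksgn_zero]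

lemma ksgn_rat_injective : Function.Injective (ksgn ℚ) := by
  have h : ∀ z : ZMod 2, z = 0 ∨ z = 1 := by decide
  intro x y
  rcases h x with rfl | rfl <;> rcases h y with rfl | rfl <;> norm_num [ksgn]

section forms

variable {n : ℕ}

/-- The bilinear form `∑_{s < t} a s * b t`: the exponent of the sign of pairing off each entry of
`a` with the later entries of `b`. -/
def bil (a b : Fin n → ZMod 2) : ZMod 2 := ∑ s, ∑ t, if s < t then a s * b t else 0

/-- The bilinear form `∑ a s * b t` over the inversions `(s, t)` of `τ`. On the diagonal it is the
exponent of the Koszul sign of `τ`. -/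
def inv (τ : Equiv.Perm (Fin n)) (a b : Fin n → ZMod 2) : ZMod 2 :=
  ∑ s, ∑ t, if s < t ∧ τ t < τ s then a s * b t else 0

lemma bil_add_left (a a' b : Fin n → ZMod 2) : bil (a + a') b = bil a b + bil a' b := by
  simp only [bil, ← Finset.sum_add_distrib, Pi.add_apply]
  refine Finset.sum_congr rfl fun _ _ => Finset.sum_congr rfl fun _ _ => ?_
  split_ifs <;> ring

lemma bil_add_right (a b b' : Fin n → ZMod 2) : bil a (b + b') = bil a b + bil a b' := by
  simp only [bil, ← Finset.sum_add_distrib, Pi.add_apply]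
  refine Finset.sum_congr rfl fun _ _ => Finset.sum_congr rfl fun _ _ => ?_
  split_ifs <;> ring

lemma inv_add_left (τ : Equiv.Perm (Fin n)) (a a' b : Fin n → ZMod 2) :
    inv τ (a + a') b = inv τ a b + inv τ a' b := by
  simp only [inv, ← Finset.sum_add_distrib, Pi.add_apply]
  refine Finset.sum_congr rfl fun _ _ => Finset.sum_congr rfl fun _ _ => ?_
  split_ifs <;> ring

lemma inv_add_right (τ : Equiv.Perm (Fin n)) (a b b' : Fin n → ZMod 2) :
    inv τ a (b + b') = inv τ a b + inv τ a b' := by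
  simp only [inv, ← Finset.sum_add_distrib, Pi.add_apply]
  refine Finset.sum_congr rfl fun _ _ => Finset.sum_congr rfl fun _ _ => ?_
  split_ifs <;> ring

lemma bil_swap (a b : Fin n → ZMod 2) :
    bil a b + bil b a + ∑ s, a s * b s = (∑ s, a s) * ∑ s, b s := by
  have h : bil b a = ∑ s, ∑ t, if t < s then a s * b t else 0 := by
    rw [bil, Finset.sum_comm]; simp only [mul_comm]
  have h' : ∑ s, a s * b s = ∑ s, ∑ t, if s = t then a s * b t else 0 := by simp
  rw [h, h', bil, Finset.sum_mul_sum]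
  simp only [← Finset.sum_add_distrib]
  refine Finset.sum_congr rfl fun s _ => Finset.sum_congr rfl fun t _ => ?_
  rcases lt_trichotomy s t with h | h | h
  · simp [h, h.not_gt, h.ne]
  · simp [h]
  · simp [h, h.not_gt, h.ne']

/-- Permuting both arguments of `bil` changes it by the inversions of the permutation. -/
lemma bil_perm (τ : Equiv.Perm (Fin n)) (a b : Fin n → ZMod 2) :
    bil a b = bil (a ∘ τ) (b ∘ τ) + inv τ (a ∘ τ) (b ∘ τ) + inv τ (b ∘ τ) (a ∘ τ) := by
  have h : inv τ (b ∘ τ) (a ∘ τ)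
      = ∑ s, ∑ t, if t < s ∧ τ s < τ t then (a ∘ τ) s * (b ∘ τ) t else 0 := by
    rw [inv, Finset.sum_comm]; simp only [mul_comm]
  have h' : bil a b = ∑ s, ∑ t, if τ s < τ t then (a ∘ τ) s * (b ∘ τ) t else 0 := by
    rw [bil, ← Equiv.sum_comp τ]
    refine Finset.sum_congr rfl fun s _ => ?_
    rw [← Equiv.sum_comp τ]
    rfl
  rw [h, h', bil, inv]
  simp only [← Finset.sum_add_distrib]
  have hz : ∀ z : ZMod 2, z + z = 0 := by decide
  refine Finset.sum_congr rfl fun s _ => Finset.sum_congr rfl fun t _ => ?_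
  generalize (a ∘ τ) s * (b ∘ τ) t = z
  rcases lt_trichotomy s t with h | h | h
  · rcases lt_or_gt_of_ne (τ.injective.ne h.ne) with h' | h' <;>
      simp [h, h.not_gt, h', h'.not_gt, hz]
  · simp [h]
  · rcases lt_or_gt_of_ne (τ.injective.ne h.ne) with h' | h' <;>
      simp [h, h.not_gt, h', h'.not_gt, hz]

/-- The Koszul sign of `τ` is the value of the form `inv τ` on the diagonal. -/
lemma koszul_eq (𝕜 : Type*) [Field 𝕜] {ι : Type*} (p : ι → ZMod 2) (τ : Equiv.Perm (Fin n))
    (i : Fin n → ι) : koszul 𝕜 p τ i = ksgn 𝕜 (inv τ (p ∘ i) (p ∘ i)) := by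
  simp only [koszul, inv, ksgn_sum, ksgn_ite, Function.comp]

lemma prod_lt_eq_ksgn_bil (𝕜 : Type*) [Field 𝕜] (a b : Fin n → ZMod 2) :
    (∏ s, ∏ t, if s < t then ksgn 𝕜 (a s * b t) else 1) = ksgn 𝕜 (bil a b) := by
  simp only [bil, ksgn_sum, ksgn_ite]

lemma inv_mul (τ ρ : Equiv.Perm (Fin n)) (a : Fin n → ZMod 2) :
    inv (τ * ρ) (a ∘ τ ∘ ρ) (a ∘ τ ∘ ρ)
      = inv τ (a ∘ τ) (a ∘ τ) + inv ρ (a ∘ τ ∘ ρ) (a ∘ τ ∘ ρ) := by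
  -- an identity of exponents follows from `koszul_mul` over `ℚ`, where signs determine exponents
  apply ksgn_rat_injective
  have := koszul_mul ℚ (id : ZMod 2 → ZMod 2) τ ρ a
  rw [koszul_eq, koszul_eq, koszul_eq, ← ksgn_add] at this
  exact this

end forms

/-- The exponent of the sign in `muCoeff`, for the parities `a` of the columns, `b` of the rows
and `p` of the letters. -/
def muExp {n : ℕ} (σ : Equiv.Perm (Fin n)) (a b p : Fin n → ZMod 2) : ZMod 2 :=
  inv σ a a + bil a (b + a) + bil (b + a) p

/-- `muCoeff` with its three Koszul signs collected in one exponent. -/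
lemma muCoeff_eq (𝕜 : Type*) [Field 𝕜] {ι υ : Type*} [DecidableEq υ] (p : ι → ZMod 2)
    (u : υ → ZMod 2) {n : ℕ} (σ : Equiv.Perm (Fin n)) (x : Fin n → ι × υ × υ) :
    muCoeff 𝕜 p u σ x = if ∀ s, (x (σ s)).2.1 = (x s).2.2 then
      ksgn 𝕜 (muExp σ (fun s => u (x s).2.2) (fun s => u (x s).2.1) (fun s => p (x s).1))
      else 0 := by
  have h : (∀ s, (x s).2.1 = (x (σ⁻¹ s)).2.2) ↔ ∀ s, (x (σ s)).2.1 = (x s).2.2 := by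
    constructor
    · intro h s; simpa using h (σ s)
    · intro h s; simpa using h (σ⁻¹ s)
  unfold muCoeff
  simp only [h]
  split_ifs with hc
  · rw [muExp, ksgn_add, ksgn_add, ← prod_lt_eq_ksgn_bil, ← prod_lt_eq_ksgn_bil, koszul_eq]
    refine congrArg₂ _ (congrArg₂ _ rfl ?_) rfl
    refine Finset.prod_congr rfl fun s _ => Finset.prod_congr rfl fun t _ => ?_
    rw [mul_comm (u _ + u _)]
    rfl
  · rfl

/-- Naturality of the sign of `muCoeff` under a simultaneous permutation of all tensor factors. -/
lemma muExp_conj {n : ℕ} (σ τ : Equiv.Perm (Fin n)) (a b p : Fin n → ZMod 2)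
    (h : ∀ s, b (σ s) = a s) :
    inv τ ((p + b + a) ∘ τ) ((p + b + a) ∘ τ) + muExp (τ⁻¹ * σ * τ) (a ∘ τ) (b ∘ τ) (p ∘ τ)
      = inv τ (p ∘ τ) (p ∘ τ) + muExp σ a b p := by
  have h1 := inv_mul σ τ b
  have h2 := inv_mul τ (τ⁻¹ * σ * τ) b
  have e : τ * (τ⁻¹ * σ * τ) = σ * τ := by group
  have e1 : b ∘ σ = a := funext h
  have e2 : b ∘ τ ∘ ⇑(τ⁻¹ * σ * τ) = a ∘ τ := by
    funext s; simp [h]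
  have e3 : b ∘ σ ∘ τ = a ∘ τ := by funext s; simp [h]
  rw [e1, e3] at h1
  rw [e, e2] at h2
  have h3 := bil_perm τ a (b + a)
  have h4 := bil_perm τ (b + a) p
  have c : ∀ f g : Fin n → ZMod 2, (f + g) ∘ τ = f ∘ τ + g ∘ τ := fun _ _ => rfl
  simp only [muExp, c, bil_add_left, bil_add_right, inv_add_left, inv_add_right] at *
  grind

/-- The sign of `muCoeff` for `W ⊗ U` in terms of those for `W` and for `U`. -/
lemma muExp_tensor {n : ℕ} (σ : Equiv.Perm (Fin n)) (a b c d p : Fin n → ZMod 2)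
    (h : ∀ s, b (σ s) = a s) (h' : ∀ s, d (σ s) = c s) :
    ∑ s, (d s + c s) * a s + (muExp σ a b p + muExp σ c d (p + b + a))
      = muExp σ (a + c) (b + d) p := by
  have e1 : b ∘ σ = a := funext h
  have e2 : d ∘ σ = c := funext h'
  have h1 := bil_perm σ d b
  rw [e1, e2] at h1
  have h2 := bil_swap d a
  have h3 := bil_swap c a
  have h4 : ∑ s, d s = ∑ s, c s := by rw [← Equiv.sum_comp σ]; simp [h']
  rw [h4] at h2
  simp only [muExp, add_mul, Finset.sum_add_distrib, bil_add_left, bil_add_right, inv_add_left,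
    inv_add_right] at *
  grind

/-! ### The algebra generated by the cyclic words -/

section algebra

variable (𝕜 : Type*) [Field 𝕜] {ι : Type*} (p : ι → ZMod 2)

lemma avg_coe {n : ℕ} (c : Tens 𝕜 ι n) :
    (avg 𝕜 p n c : Tens 𝕜 ι n) = (n.factorial : 𝕜)⁻¹ • ∑ τ : Equiv.Perm (Fin n), act 𝕜 p τ c := by
  change ((n.factorial : 𝕜)⁻¹ • ∑ τ : Equiv.Perm (Fin n), act 𝕜 p τ) c = _
  rw [LinearMap.smul_apply, LinearMap.sum_apply]

lemma avg_act {n : ℕ} (τ : Equiv.Perm (Fin n)) (c : Tens 𝕜 ι n) :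
    avg 𝕜 p n (act 𝕜 p τ c) = avg 𝕜 p n c := by
  apply Subtype.ext
  rw [avg_coe, avg_coe]
  simp only [act_act]
  congr 1
  exact Equiv.sum_comp (Equiv.mulRight τ) (fun ρ => act 𝕜 p ρ c)

lemma factorial_inv_mul_card [CharZero 𝕜] (n : ℕ) :
    (n.factorial : 𝕜)⁻¹ * (Fintype.card (Equiv.Perm (Fin n)) : 𝕜) = 1 := by
  rw [Fintype.card_perm, Fintype.card_fin]
  exact inv_mul_cancel₀ (by exact_mod_cast n.factorial_ne_zero)

lemma avg_of_mem [CharZero 𝕜] {n : ℕ} (c : Fn 𝕜 p n) : avg 𝕜 p n (c : Tens 𝕜 ι n) = c := by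
  apply Subtype.ext
  rw [avg_coe]
  have h : ∀ τ, act 𝕜 p τ (c : Tens 𝕜 ι n) = c := c.2
  simp only [h, Finset.sum_const, Finset.card_univ]
  rw [← Nat.cast_smul_eq_nsmul 𝕜, smul_smul, factorial_inv_mul_card, one_smul]

/-- A linear map on tensors that does not distinguish the translates of a tensor does not
distinguish a tensor from its average. -/
lemma map_avg [CharZero 𝕜] {n : ℕ} {X : Type*} [AddCommGroup X] [Module 𝕜 X]
    (f : Tens 𝕜 ι n →ₗ[𝕜] X) (hf : ∀ τ c, f (act 𝕜 p τ c) = f c) (c : Tens 𝕜 ι n) :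
    f (avg 𝕜 p n c) = f c := by
  rw [avg_coe]
  simp only [map_smul, map_sum, hf, Finset.sum_const, Finset.card_univ]
  rw [← Nat.cast_smul_eq_nsmul 𝕜, smul_smul, factorial_inv_mul_card, one_smul]

lemma blockPerm_castAdd {m n : ℕ} (σ : Equiv.Perm (Fin m)) (σ' : Equiv.Perm (Fin n)) (s : Fin m) :
    blockPerm σ σ' (Fin.castAdd n s) = Fin.castAdd n (σ s) := by
  simp [blockPerm, Equiv.permCongr_apply]

lemma blockPerm_natAdd {m n : ℕ} (σ : Equiv.Perm (Fin m)) (σ' : Equiv.Perm (Fin n)) (s : Fin n) :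
    blockPerm σ σ' (Fin.natAdd m s) = Fin.natAdd m (σ' s) := by
  simp [blockPerm, Equiv.permCongr_apply]

lemma blockPerm_mul {m n : ℕ} (σ τ : Equiv.Perm (Fin m)) (σ' τ' : Equiv.Perm (Fin n)) :
    blockPerm (σ * τ) (σ' * τ') = blockPerm σ σ' * blockPerm τ τ' := by
  ext s
  refine Fin.addCases (fun s => ?_) (fun s => ?_) s <;>
    simp [blockPerm_castAdd, blockPerm_natAdd]

lemma blockPerm_inv {m n : ℕ} (σ : Equiv.Perm (Fin m)) (σ' : Equiv.Perm (Fin n)) :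
    (blockPerm σ σ')⁻¹ = blockPerm σ⁻¹ σ'⁻¹ := by
  rw [inv_eq_iff_mul_eq_one, ← blockPerm_mul]
  ext s
  refine Fin.addCases (fun s => ?_) (fun s => ?_) s <;>
    simp [blockPerm_castAdd, blockPerm_natAdd]

lemma inv_blockPerm {m n : ℕ} (σ : Equiv.Perm (Fin m)) (σ' : Equiv.Perm (Fin n))
    (a : Fin (m + n) → ZMod 2) :
    inv (blockPerm σ σ') a a = inv σ (a ∘ Fin.castAdd n) (a ∘ Fin.castAdd n)
      + inv σ' (a ∘ Fin.natAdd m) (a ∘ Fin.natAdd m) := by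
  have h1 : ∀ (s : Fin m) (t : Fin n), Fin.castAdd n s < Fin.natAdd m t := fun s t => by
    rw [Fin.lt_def]; simp; omega
  have hlt : ∀ s t : Fin m, Fin.castAdd n s < Fin.castAdd n t ↔ s < t := fun _ _ => Iff.rfl
  simp only [inv, Fin.sum_univ_add, blockPerm_castAdd, blockPerm_natAdd, h1, (h1 _ _).not_gt,
    and_false, false_and, if_false, Finset.sum_const_zero, add_zero, zero_add,
    Function.comp_apply, Fin.natAdd_lt_natAdd_iff, hlt]

lemma bil_append {m n : ℕ} (a b : Fin (m + n) → ZMod 2) :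
    bil a b = bil (a ∘ Fin.castAdd n) (b ∘ Fin.castAdd n)
      + bil (a ∘ Fin.natAdd m) (b ∘ Fin.natAdd m)
      + (∑ s, a (Fin.castAdd n s)) * ∑ t, b (Fin.natAdd m t) := by
  have h1 : ∀ (s : Fin m) (t : Fin n), Fin.castAdd n s < Fin.natAdd m t := fun s t => by
    rw [Fin.lt_def]; simp; omega
  have hlt : ∀ s t : Fin m, Fin.castAdd n s < Fin.castAdd n t ↔ s < t := fun _ _ => Iff.rfl
  simp only [bil, Fin.sum_univ_add, h1, (h1 _ _).not_gt, if_true,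
    if_false, Finset.sum_const_zero, Finset.sum_add_distrib, Finset.sum_mul_sum,
    Function.comp_apply, Fin.natAdd_lt_natAdd_iff, hlt]
  ring

lemma koszul_blockPerm {m n : ℕ} (σ : Equiv.Perm (Fin m)) (σ' : Equiv.Perm (Fin n))
    (i : Fin (m + n) → ι) :
    koszul 𝕜 p (blockPerm σ σ') i
      = koszul 𝕜 p σ (i ∘ Fin.castAdd n) * koszul 𝕜 p σ' (i ∘ Fin.natAdd m) := by
  simp only [koszul_eq, ← ksgn_add]
  exact congrArg _ (inv_blockPerm σ σ' (p ∘ i))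

lemma koszul_ne_zero {n : ℕ} (τ : Equiv.Perm (Fin n)) (i : Fin n → ι) :
    koszul 𝕜 p τ i ≠ 0 := by
  rw [koszul_eq]; exact ksgn_ne_zero _ _

lemma juxt_apply {m n : ℕ} (f : Tens 𝕜 ι m) (g : Tens 𝕜 ι n) (i : Fin (m + n) → ι)
    (σ : Equiv.Perm (Fin (m + n))) :
    juxt 𝕜 f g i σ = ∑ σ₁ : Equiv.Perm (Fin m), ∑ σ₂ : Equiv.Perm (Fin n),
      if blockPerm σ₁ σ₂ = σ then f (i ∘ Fin.castAdd n) σ₁ * g (i ∘ Fin.natAdd m) σ₂ else 0 := rfl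

lemma act_apply {n : ℕ} (τ : Equiv.Perm (Fin n)) (c : Tens 𝕜 ι n) (i : Fin n → ι)
    (σ : Equiv.Perm (Fin n)) :
    act 𝕜 p τ c i σ = koszul 𝕜 p τ (i ∘ τ) * c (i ∘ τ) (τ⁻¹ * σ * τ) := rfl

lemma juxt_act {m n : ℕ} (τ : Equiv.Perm (Fin m)) (τ' : Equiv.Perm (Fin n)) (f : Tens 𝕜 ι m)
    (g : Tens 𝕜 ι n) :
    juxt 𝕜 (act 𝕜 p τ f) (act 𝕜 p τ' g) = act 𝕜 p (blockPerm τ τ') (juxt 𝕜 f g) := by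
  funext i σ
  rw [act_apply, juxt_apply, juxt_apply, ← (MulAut.conj τ).toEquiv.sum_comp, Finset.mul_sum]
  refine Finset.sum_congr rfl fun σ₁ _ => ?_
  rw [← (MulAut.conj τ').toEquiv.sum_comp, Finset.mul_sum]
  refine Finset.sum_congr rfl fun σ₂ _ => ?_
  have e1 : (i ∘ blockPerm τ τ') ∘ Fin.castAdd n = (i ∘ Fin.castAdd n) ∘ τ := by
    funext s; simp [blockPerm_castAdd]
  have e2 : (i ∘ blockPerm τ τ') ∘ Fin.natAdd m = (i ∘ Fin.natAdd m) ∘ τ' := by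
    funext s; simp [blockPerm_natAdd]
  have e3 : blockPerm (τ * σ₁ * τ⁻¹) (τ' * σ₂ * τ'⁻¹) = σ
      ↔ blockPerm σ₁ σ₂ = (blockPerm τ τ')⁻¹ * σ * blockPerm τ τ' := by
    rw [blockPerm_mul, blockPerm_mul, ← blockPerm_inv]
    constructor
    · rintro rfl; group
    · intro h; rw [h]; group
  simp only [MulEquiv.toEquiv_eq_coe, MulEquiv.coe_toEquiv, MulAut.conj_apply, e3]
  split_ifs
  · rw [act_apply, act_apply, koszul_blockPerm, e1, e2]
    have g1 : τ⁻¹ * (τ * σ₁ * τ⁻¹) * τ = σ₁ := by group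
    have g2 : τ'⁻¹ * (τ' * σ₂ * τ'⁻¹) * τ' = σ₂ := by group
    rw [g1, g2]
    ring
  · simp

lemma mul_ofFn {m n : ℕ} (f : Fn 𝕜 p m) (g : Fn 𝕜 p n) :
    mul 𝕜 p (ofFn 𝕜 p m f) (ofFn 𝕜 p n g)
      = ofFn 𝕜 p (m + n) (avg 𝕜 p (m + n) (juxt 𝕜 (f : Tens 𝕜 ι m) (g : Tens 𝕜 ι n))) := by
  simp [mul, ofFn, LinearMap.domRestrict₁₂_apply]

lemma mul_avg [CharZero 𝕜] {m n : ℕ} (f : Tens 𝕜 ι m) (g : Tens 𝕜 ι n) :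
    mul 𝕜 p (ofFn 𝕜 p m (avg 𝕜 p m f)) (ofFn 𝕜 p n (avg 𝕜 p n g))
      = ofFn 𝕜 p (m + n) (avg 𝕜 p (m + n) (juxt 𝕜 f g)) := by
  have hid : ∀ {n : ℕ} (c : Tens 𝕜 ι n), act 𝕜 p 1 c = c := fun {n} c => by
    funext i σ
    have h : koszul 𝕜 p (1 : Equiv.Perm (Fin n)) i = 1 :=
      Finset.prod_eq_one fun s _ => Finset.prod_eq_one fun t _ =>
        if_neg fun h => absurd h.1 h.2.not_gt
    rw [act_apply]
    change koszul 𝕜 p 1 i * c i (1⁻¹ * σ * 1) = _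
    rw [h, one_mul, inv_one, one_mul, mul_one]
  rw [mul_ofFn]
  congr 1
  -- both factors may be replaced by their averages, one at a time
  have h1 := map_avg 𝕜 p ((avg 𝕜 p (m + n)) ∘ₗ (juxt 𝕜).flip (avg 𝕜 p n g : Tens 𝕜 ι n))
    (fun τ c => by
      have hg : act 𝕜 p 1 (avg 𝕜 p n g : Tens 𝕜 ι n) = avg 𝕜 p n g := hid _
      simp only [LinearMap.comp_apply, LinearMap.flip_apply]
      rw [← hg, juxt_act, avg_act, hg]) f
  have h2 := map_avg 𝕜 p ((avg 𝕜 p (m + n)) ∘ₗ (juxt 𝕜) f)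
    (fun τ c => by
      simp only [LinearMap.comp_apply]
      rw [← hid f, juxt_act, avg_act, hid]) g
  exact h1.trans h2

lemma ofFn_induction {P : F 𝕜 p → Prop} (h0 : P 0) (hof : ∀ n c, P (ofFn 𝕜 p n c))
    (hadd : ∀ f g, P f → P g → P (f + g)) (f : F 𝕜 p) : P f :=
  DirectSum.induction_on f h0 hof hadd

lemma ofFn_apply_self {n : ℕ} (c : Fn 𝕜 p n) : ofFn 𝕜 p n c n = c := DirectSum.of_eq_same _ _

end algebra

/-- In every permutation of a nonempty set, the cycle of a point can be split off. -/
lemma exists_split_cycle {n : ℕ} (σ : Equiv.Perm (Fin (n + 1))) :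
    ∃ (r m : ℕ) (e : Fin (r + 1) ⊕ Fin m ≃ Fin (n + 1)) (σ' : Equiv.Perm (Fin m)),
      (∀ k, σ (e (Sum.inl k)) = e (Sum.inl (finRotate (r + 1) k))) ∧
      ∀ j, σ (e (Sum.inr j)) = e (Sum.inr (σ' j)) := by
  classical
  have hper : 0 < Function.minimalPeriod σ 0 :=
    Function.minimalPeriod_pos_of_mem_periodicPts
      (Function.Injective.mem_periodicPts σ.injective 0)
  obtain ⟨r, hr⟩ : ∃ r, Function.minimalPeriod σ 0 = r + 1 := ⟨_, (Nat.sub_add_cancel hper).symm⟩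
  set f : Fin (r + 1) → Fin (n + 1) := fun k => σ^[k] 0 with hf
  have hinj : Function.Injective f := fun k k' h => by
    apply Fin.ext
    exact Function.iterate_injOn_Iio_minimalPeriod (hr.symm ▸ k.2 : (k : ℕ) < _)
      (hr.symm ▸ k'.2 : (k' : ℕ) < _) h
  have hrot : ∀ k, σ (f k) = f (finRotate (r + 1) k) := fun k => by
    have : ((finRotate (r + 1) k : Fin (r + 1)) : ℕ) = ((k : ℕ) + 1) % (r + 1) := by
      rw [finRotate_apply, Fin.val_add]
      cases r <;> simp
    have h := Function.iterate_mod_minimalPeriod_eq (f := σ) (x := 0) (n := (k : ℕ) + 1)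
    rw [hr, Function.iterate_succ_apply'] at h
    simp only [hf, this]
    exact h.symm
  have hmem : ∀ y, y ∈ (Set.range f)ᶜ ↔ σ y ∈ (Set.range f)ᶜ := fun y => by
    rw [not_iff_not.symm]
    simp only [Set.mem_compl_iff, not_not]
    constructor
    · rintro ⟨k, rfl⟩; exact ⟨_, (hrot k).symm⟩
    · rintro ⟨k, hk⟩
      refine ⟨(finRotate (r + 1)).symm k, σ.injective ?_⟩
      rw [hrot, Equiv.apply_symm_apply, hk]
  let e₁ : Fin (r + 1) ≃ Set.range f := Equiv.ofInjective f hinj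
  let e₂ : ((Set.range f)ᶜ : Set _) ≃ Fin (Fintype.card ((Set.range f)ᶜ : Set _)) :=
    Fintype.equivFin _
  refine ⟨r, _, (Equiv.sumCongr e₁ e₂.symm).trans (Equiv.Set.sumCompl _),
    e₂.permCongr (σ.subtypePerm fun y => (hmem y).symm), fun k => ?_, fun j => ?_⟩
  · simp [e₁, hrot]
  · simp [Equiv.permCongr_apply]

section generation

variable (𝕜 : Type*) [Field 𝕜] {ι : Type*} [DecidableEq ι] (p : ι → ZMod 2)

/-- The basis tensor `a_{i 0} ⊗ ⋯ ⊗ a_{i (n-1)} ⊗ σ`. -/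
def basisTens {n : ℕ} (i : Fin n → ι) (σ : Equiv.Perm (Fin n)) : Tens 𝕜 ι n :=
  fun j τ => if j = i ∧ τ = σ then 1 else 0

lemma juxt_basisTens {m n : ℕ} (i : Fin m → ι) (σ : Equiv.Perm (Fin m)) (i' : Fin n → ι)
    (σ' : Equiv.Perm (Fin n)) :
    juxt 𝕜 (basisTens 𝕜 i σ) (basisTens 𝕜 i' σ')
      = basisTens 𝕜 (Fin.append i i') (blockPerm σ σ') := by
  funext j τ
  have h : j = Fin.append i i' ↔ j ∘ Fin.castAdd n = i ∧ j ∘ Fin.natAdd m = i' := by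
    constructor
    · rintro rfl
      exact ⟨funext fun s => by simp, funext fun s => by simp⟩
    · rintro ⟨rfl, rfl⟩
      funext s
      refine Fin.addCases (fun s => ?_) (fun s => ?_) s <;> simp
  rw [juxt_apply, Finset.sum_eq_single σ, Finset.sum_eq_single σ']
  · simp only [basisTens, h, eq_comm (a := τ)]
    split_ifs <;> simp_all
  · intro b _ hb; simp [basisTens, hb]
  · simp
  · intro b _ hb; simp [basisTens, hb]
  · simp

lemma act_basisTens {n : ℕ} (τ σ : Equiv.Perm (Fin n)) (i : Fin n → ι) :
    act 𝕜 p τ (basisTens 𝕜 (i ∘ τ) (τ⁻¹ * σ * τ)) = koszul 𝕜 p τ (i ∘ τ) • basisTens 𝕜 i σ := by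
  funext j ρ
  have h1 : j ∘ τ = i ∘ τ ↔ j = i := τ.surjective.injective_comp_right.eq_iff
  have h2 : τ⁻¹ * ρ * τ = τ⁻¹ * σ * τ ↔ ρ = σ := by simp
  rw [act_apply]
  simp only [basisTens, h1, h2, Pi.smul_apply, smul_eq_mul]
  by_cases h : j = i
  · rw [h]
  · simp [h]

/-- `F(V)` is generated by the cyclic words: a linear map that agrees with another one on the unit
and on the products of a cyclic word with elements on which they agree is equal to it. -/
lemma ext_of_cyc [CharZero 𝕜] [Fintype ι] {X : Type*} [AddCommGroup X] [Module 𝕜 X]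
    (M M' : F 𝕜 p →ₗ[𝕜] X)
    (h1 : M (one 𝕜 p) = M' (one 𝕜 p))
    (hmul : ∀ (r : ℕ) (w : Fin (r + 1) → ι) (f : F 𝕜 p), M f = M' f →
      M (mul 𝕜 p (cyc 𝕜 p w) f) = M' (mul 𝕜 p (cyc 𝕜 p w) f)) : M = M' := by
  have key : ∀ (n : ℕ) (i : Fin n → ι) (σ : Equiv.Perm (Fin n)),
      M (ofFn 𝕜 p n (avg 𝕜 p n (basisTens 𝕜 i σ)))
        = M' (ofFn 𝕜 p n (avg 𝕜 p n (basisTens 𝕜 i σ))) := by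
    intro n
    induction n using Nat.strong_induction_on with
    | _ n ih =>
      intro i σ
      rcases n with _ | n
      · have : basisTens 𝕜 i σ = fun _ _ => 1 := by
          funext j τ
          exact if_pos ⟨Subsingleton.elim _ _, Subsingleton.elim _ _⟩
        rw [this]
        exact h1
      · obtain ⟨r, m, e, σ', he1, he2⟩ := exists_split_cycle σ
        have hn : n + 1 = r + 1 + m := by
          have := Fintype.card_congr e; simp at this; omega
        generalize n + 1 = n' at *
        subst hn
        let τ : Equiv.Perm (Fin (r + 1 + m)) := finSumFinEquiv.symm.trans e
        have hτ : τ⁻¹ * σ * τ = blockPerm (finRotate (r + 1)) σ' := by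
          rw [mul_assoc, inv_mul_eq_iff_eq_mul]
          ext s
          refine Fin.addCases (fun s => ?_) (fun s => ?_) s
          · simp [τ, blockPerm_castAdd, he1, -finRotate_apply]
          · simp [τ, blockPerm_natAdd, he2]
        have hi : i ∘ τ = Fin.append ((i ∘ τ) ∘ Fin.castAdd m) ((i ∘ τ) ∘ Fin.natAdd (r + 1)) := by
          funext s
          refine Fin.addCases (fun s => ?_) (fun s => ?_) s <;> simp
        have h2 := congrArg (avg 𝕜 p _) (act_basisTens 𝕜 p τ σ i)
        rw [avg_act, map_smul, hτ, hi, ← juxt_basisTens] at h2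
        have h3 : ofFn 𝕜 p _ (avg 𝕜 p _ (basisTens 𝕜 i σ)) = (koszul 𝕜 p τ (i ∘ τ))⁻¹ •
            mul 𝕜 p (cyc 𝕜 p ((i ∘ τ) ∘ Fin.castAdd m))
              (ofFn 𝕜 p m (avg 𝕜 p m (basisTens 𝕜 ((i ∘ τ) ∘ Fin.natAdd (r + 1)) σ'))) := by
          have h4 : cyc 𝕜 p ((i ∘ τ) ∘ Fin.castAdd m)
            = ofFn 𝕜 p (r + 1) (avg 𝕜 p (r + 1) (basisTens 𝕜 ((i ∘ τ) ∘ Fin.castAdd m)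
                (finRotate (r + 1)))) := rfl
          rw [h4, mul_avg, h2, map_smul, ← hi, smul_smul,
            inv_mul_cancel₀ (koszul_ne_zero 𝕜 p τ _), one_smul]
        rw [h3, map_smul, map_smul, hmul _ _ _ (ih m (by omega) _ _)]
  refine LinearMap.ext fun f => ?_
  induction f using ofFn_induction with
  | h0 => simp
  | hadd f g hf hg => rw [map_add, map_add, hf, hg]
  | hof n c =>
    rw [← avg_of_mem 𝕜 p c]
    have : (c : Tens 𝕜 ι n) = ∑ i, ∑ σ, c.1 i σ • basisTens 𝕜 i σ := by
      funext j τ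
      simp [basisTens, Finset.sum_apply, ite_and]
    rw [this]
    simp only [map_sum, map_smul, key]

end generation

/-! ### The trace map -/

section traceMap

variable {𝕜 : Type*} [Field 𝕜] {ι κ : Type*} [DecidableEq κ] (p : ι → ZMod 2) (q : κ → ZMod 2)

variable (𝕜) in
/-- The map `V^{⊗ n} ⊗ 𝕜[Sₙ] → (V ⊗ End W)^{⊗ n} ⊗ 𝕜[Sₙ]` that tensors `v ⊗ σ` with the permutation
of tensors `μ(σ) ∈ End(W)^{⊗ n}`. -/
def traceTens (n : ℕ) : Tens 𝕜 ι n →ₗ[𝕜] Tens 𝕜 (ι × κ × κ) n where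
  toFun c := fun x σ => c (fun s => (x s).1) σ * muCoeff 𝕜 p q σ x
  map_add' c d := by funext x σ; simp [add_mul]
  map_smul' r c := by funext x σ; simp [mul_assoc]

lemma traceTens_apply {n : ℕ} (c : Tens 𝕜 ι n) (x : Fin n → ι × κ × κ)
    (σ : Equiv.Perm (Fin n)) :
    traceTens 𝕜 p q n c x σ = c (fun s => (x s).1) σ * muCoeff 𝕜 p q σ x := rfl

lemma act_traceTens {n : ℕ} (τ : Equiv.Perm (Fin n)) (c : Tens 𝕜 ι n) :
    act 𝕜 (glParity p q) τ (traceTens 𝕜 p q n c) = traceTens 𝕜 p q n (act 𝕜 p τ c) := by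
  funext x σ
  rw [act_apply, traceTens_apply, traceTens_apply, act_apply, muCoeff_eq, muCoeff_eq]
  have h : (∀ s, ((x ∘ τ) ((τ⁻¹ * σ * τ) s)).2.1 = ((x ∘ τ) s).2.2)
      ↔ ∀ s, (x (σ s)).2.1 = (x s).2.2 := by
    rw [← τ.forall_congr_right (q := fun s => (x (σ s)).2.1 = (x s).2.2)]
    simp
  simp only [h]
  split_ifs with hc
  · rw [koszul_eq, koszul_eq]
    have := congrArg (ksgn 𝕜) (muExp_conj σ τ (fun s => q (x s).2.2) (fun s => q (x s).2.1)
      (fun s => p (x s).1) (fun s => congrArg q (hc s)))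
    rw [ksgn_add, ksgn_add] at this
    rw [mul_left_comm, mul_right_comm, mul_comm]
    exact congrArg (· * c ((fun s => (x s).1) ∘ τ) (τ⁻¹ * σ * τ)) this
  · simp

lemma juxt_traceTens {m n : ℕ} (f : Tens 𝕜 ι m) (g : Tens 𝕜 ι n) :
    traceTens 𝕜 p q (m + n) (juxt 𝕜 f g)
      = juxt 𝕜 (traceTens 𝕜 p q m f) (traceTens 𝕜 p q n g) := by
  funext x σ
  rw [traceTens_apply, juxt_apply, juxt_apply, Finset.sum_mul]
  refine Finset.sum_congr rfl fun σ₁ _ => ?_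
  rw [Finset.sum_mul]
  refine Finset.sum_congr rfl fun σ₂ _ => ?_
  split_ifs with h
  swap
  · simp
  subst h
  have key : muCoeff 𝕜 p q (blockPerm σ₁ σ₂) x
      = muCoeff 𝕜 p q σ₁ (x ∘ Fin.castAdd n) * muCoeff 𝕜 p q σ₂ (x ∘ Fin.natAdd m) := by
    rw [muCoeff_eq, muCoeff_eq, muCoeff_eq]
    have h : (∀ s, (x (blockPerm σ₁ σ₂ s)).2.1 = (x s).2.2)
        ↔ (∀ s, ((x ∘ Fin.castAdd n) (σ₁ s)).2.1 = ((x ∘ Fin.castAdd n) s).2.2)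
          ∧ ∀ s, ((x ∘ Fin.natAdd m) (σ₂ s)).2.1 = ((x ∘ Fin.natAdd m) s).2.2 := by
      constructor
      · intro h
        exact ⟨fun s => by simpa [blockPerm_castAdd] using h (Fin.castAdd n s),
          fun s => by simpa [blockPerm_natAdd] using h (Fin.natAdd m s)⟩
      · rintro ⟨h1, h2⟩ s
        refine Fin.addCases (fun s => ?_) (fun s => ?_) s
        · simpa [blockPerm_castAdd] using h1 s
        · simpa [blockPerm_natAdd] using h2 s
    simp only [h]
    by_cases h1 : ∀ s, ((x ∘ Fin.castAdd n) (σ₁ s)).2.1 = ((x ∘ Fin.castAdd n) s).2.2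
    swap
    · simp only [h1, false_and, if_false, zero_mul]
    by_cases h2 : ∀ s, ((x ∘ Fin.natAdd m) (σ₂ s)).2.1 = ((x ∘ Fin.natAdd m) s).2.2
    swap
    · simp only [h2, and_false, if_false, mul_zero]
    simp only [h1, h2, implies_true, and_self, if_true]
    rw [← ksgn_add]
    congr 1
    have e1 : ∑ s, (q (x (Fin.castAdd n s)).2.1 + q (x (Fin.castAdd n s)).2.2) = 0 := by
      have h1' : ∀ s, (x (Fin.castAdd n (σ₁ s))).2.1 = (x (Fin.castAdd n s)).2.2 := h1
      rw [Finset.sum_add_distrib, ← Equiv.sum_comp σ₁]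
      simp only [h1']
      exact CharTwo.add_self_eq_zero _
    have e2 : ∑ s, (q (x (Fin.natAdd m s)).2.1 + q (x (Fin.natAdd m s)).2.2) = 0 := by
      have h2' : ∀ s, (x (Fin.natAdd m (σ₂ s))).2.1 = (x (Fin.natAdd m s)).2.2 := h2
      rw [Finset.sum_add_distrib, ← Equiv.sum_comp σ₂]
      simp only [h2']
      exact CharTwo.add_self_eq_zero _
    simp only [muExp, inv_blockPerm, bil_append, Pi.add_apply, e1, e2, mul_zero, zero_mul, add_zero]
    simp only [Function.comp_def, Pi.add_def]
    ring
  rw [key, traceTens_apply, traceTens_apply]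
  simp only [Function.comp_def]
  ring

/-- The total parity is not changed by `traceTens`. -/
lemma sum_glParity_of_muCoeff_ne_zero {n : ℕ} {σ : Equiv.Perm (Fin n)} {x : Fin n → ι × κ × κ}
    (h : muCoeff 𝕜 p q σ x ≠ 0) : ∑ s, glParity p q (x s) = ∑ s, p (x s).1 := by
  rw [muCoeff_eq] at h
  have hc : ∀ s, (x (σ s)).2.1 = (x s).2.2 := by
    by_contra hc
    rw [if_neg hc] at h
    exact h rfl
  have : ∑ s, q (x s).2.1 = ∑ s, q (x s).2.2 := by
    rw [← Equiv.sum_comp σ]; simp only [hc]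
  simp only [glParity, Finset.sum_add_distrib, this, add_assoc, CharTwo.add_self_eq_zero, add_zero]

/-- The restriction of `traceTens` to invariant tensors. -/
def traceFn (n : ℕ) : Fn 𝕜 p n →ₗ[𝕜] Fn 𝕜 (glParity p q) n :=
  (traceTens 𝕜 p q n).restrict fun c hc τ => by
    rw [act_traceTens, hc τ]

lemma traceFn_avg {n : ℕ} (c : Tens 𝕜 ι n) :
    traceFn p q n (avg 𝕜 p n c) = avg 𝕜 (glParity p q) n (traceTens 𝕜 p q n c) := by
  apply Subtype.ext
  change traceTens 𝕜 p q n (avg 𝕜 p n c : Tens 𝕜 ι n) = _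
  rw [avg_coe, avg_coe]
  simp only [map_smul, map_sum, act_traceTens]

variable (𝕜) in
/-- The trace map `F(V) → F(V ⊗ End W)`. -/
noncomputable def traceMap : F 𝕜 p →ₗ[𝕜] F 𝕜 (glParity p q) :=
  DirectSum.lmap fun n => traceFn p q n

lemma traceMap_ofFn {n : ℕ} (c : Fn 𝕜 p n) :
    traceMap 𝕜 p q (ofFn 𝕜 p n c) = ofFn 𝕜 (glParity p q) n (traceFn p q n c) :=
  DirectSum.lmap_lof _ _ _

lemma traceMap_apply (f : F 𝕜 p) (n : ℕ) : traceMap 𝕜 p q f n = traceFn p q n (f n) :=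
  DirectSum.lmap_apply _ _ _

lemma coe_traceMap_apply (f : F 𝕜 p) (n : ℕ) :
    (traceMap 𝕜 p q f n : Tens 𝕜 _ n) = traceTens 𝕜 p q n (f n) := by
  rw [traceMap_apply]; rfl

lemma traceMap_avg {n : ℕ} (c : Tens 𝕜 ι n) :
    traceMap 𝕜 p q (ofFn 𝕜 p n (avg 𝕜 p n c))
      = ofFn 𝕜 (glParity p q) n (avg 𝕜 (glParity p q) n (traceTens 𝕜 p q n c)) := by
  rw [traceMap_ofFn, traceFn_avg]

lemma traceMap_one : traceMap 𝕜 p q (one 𝕜 p) = one 𝕜 (glParity p q) := by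
  rw [one, traceMap_avg]
  congr 2
  funext x σ
  rw [traceTens_apply, muCoeff_eq, if_pos (fun s => s.elim0)]
  simp [muExp, inv, bil, ksgn_zero]

lemma traceMap_mul (f g : F 𝕜 p) :
    traceMap 𝕜 p q (mul 𝕜 p f g)
      = mul 𝕜 (glParity p q) (traceMap 𝕜 p q f) (traceMap 𝕜 p q g) := by
  induction f using ofFn_induction with
  | h0 => simp
  | hadd f f' hf hf' => simp only [map_add, LinearMap.add_apply, hf, hf']
  | hof m a =>
    induction g using ofFn_induction with
    | h0 => simp
    | hadd g g' hg hg' => simp only [map_add, hg, hg']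
    | hof n b =>
      rw [mul_ofFn, traceMap_avg, juxt_traceTens, traceMap_ofFn, traceMap_ofFn, mul_ofFn]
      rfl

lemma parityOp_ofFn {n : ℕ} (c : Fn 𝕜 p n) :
    parityOp 𝕜 p (ofFn 𝕜 p n c)
      = ofFn 𝕜 p n (avg 𝕜 p n fun i σ => ksgn 𝕜 (∑ s, p (i s)) * c.1 i σ) := by
  simp [parityOp, ofFn]

lemma traceMap_parityOp (f : F 𝕜 p) :
    traceMap 𝕜 p q (parityOp 𝕜 p f) = parityOp 𝕜 (glParity p q) (traceMap 𝕜 p q f) := by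
  induction f using ofFn_induction with
  | h0 => simp
  | hadd f g hf hg => simp only [map_add, hf, hg]
  | hof n c =>
    rw [parityOp_ofFn, traceMap_avg, traceMap_ofFn, parityOp_ofFn]
    congr 2
    funext x σ
    change _ * _ = _ * (c.1 _ σ * muCoeff 𝕜 p q σ x)
    by_cases h : muCoeff 𝕜 p q σ x = 0
    · simp [h]
    · rw [sum_glParity_of_muCoeff_ne_zero p q h, mul_assoc]

lemma isEven_traceMap {f : F 𝕜 p} (hf : IsEven 𝕜 p f) :
    IsEven 𝕜 (glParity p q) (traceMap 𝕜 p q f) := by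
  intro n x σ h
  rw [coe_traceMap_apply, traceTens_apply] at h
  rw [sum_glParity_of_muCoeff_ne_zero p q (right_ne_zero_of_mul h)]
  exact hf n _ σ (left_ne_zero_of_mul h)

lemma muCoeff_const_ne_zero {n : ℕ} (i : Fin n → ι) (σ : Equiv.Perm (Fin n)) (β : κ) :
    muCoeff 𝕜 p q σ (fun s => (i s, β, β)) ≠ 0 := by
  rw [muCoeff_eq, if_pos (fun _ => rfl)]
  exact ksgn_ne_zero _ _

lemma traceMap_injective [Nonempty κ] : Function.Injective (traceMap 𝕜 p q) := by
  obtain ⟨β⟩ := ‹Nonempty κ›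
  rw [injective_iff_map_eq_zero]
  intro f hf
  refine DFinsupp.ext fun n => Subtype.ext ?_
  funext i σ
  have h : (traceMap 𝕜 p q f n : Tens 𝕜 _ n) (fun s => (i s, β, β)) σ = 0 := by rw [hf]; rfl
  rw [coe_traceMap_apply, traceTens_apply] at h
  exact (mul_eq_zero.1 h).resolve_right (muCoeff_const_ne_zero p q i σ β)

lemma isEven_of_traceMap [Nonempty κ] {f : F 𝕜 p}
    (hf : IsEven 𝕜 (glParity p q) (traceMap 𝕜 p q f)) : IsEven 𝕜 p f := by
  obtain ⟨β⟩ := ‹Nonempty κ›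
  intro n i σ h
  have hx := muCoeff_const_ne_zero (𝕜 := 𝕜) p q i σ β
  rw [← sum_glParity_of_muCoeff_ne_zero p q hx]
  refine hf n _ σ ?_
  rw [coe_traceMap_apply, traceTens_apply]
  exact mul_ne_zero h hx

end traceMap

section cyc

/-- The sum telescopes since signs cancel in characteristic two. -/
lemma sum_lt_telescope {r : ℕ} (b : Fin (r + 1) → ZMod 2) (t : Fin (r + 1)) :
    ∑ s, (if s < t then b s + b (s + 1) else 0) = b 0 + b t := by
  have hz : ∀ z : ZMod 2, z + z = 0 := by decide
  induction t using Fin.induction with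
  | zero => simp [hz]
  | succ t ih =>
    have h : ∀ s : Fin (r + 1), (if s < t.succ then b s + b (s + 1) else 0)
        = (if s < t.castSucc then b s + b (s + 1) else 0)
          + if s = t.castSucc then b s + b (s + 1) else 0 := fun s => by
      rcases lt_trichotomy s t.castSucc with h | h | h
      · simp [h, h.ne, h.trans t.castSucc_lt_succ]
      · simp [h]
      · have : ¬ s < t.succ := not_lt.2 (Fin.castSucc_lt_iff_succ_le.1 h)
        simp [h.not_gt, h.ne', this]
    rw [Finset.sum_congr rfl fun s _ => h s, Finset.sum_add_distrib, ih, Finset.sum_ite_eq']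
    simp only [Finset.mem_univ, if_true, Fin.coeSucc_eq_succ]
    linear_combination hz (b t.castSucc)

lemma inv_finRotate {r : ℕ} (a : Fin (r + 1) → ZMod 2) :
    inv (finRotate (r + 1)) a a = (∑ s : Fin r, a s.castSucc) * a (Fin.last r) := by
  have h1 : ∀ s : Fin r, finRotate (r + 1) s.castSucc = s.succ := fun s => by
    rw [finRotate_apply, Fin.coeSucc_eq_succ]
  have h2 : ∀ s t : Fin r, ¬ (s.castSucc < t.castSucc ∧ t.succ < s.succ) := fun s t h => by
    rw [Fin.succ_lt_succ_iff] at h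
    exact absurd h.1 (not_lt.2 (Fin.castSucc_le_castSucc_iff.2 h.2.le))
  have h3 : ∀ s : Fin r, ¬ Fin.last r < s.castSucc := fun s => (Fin.castSucc_lt_last s).not_gt
  simp only [inv, Fin.sum_univ_castSucc, h1, finRotate_last, h2, h3, lt_self_iff_false, false_and,
    if_false, Finset.sum_const_zero, zero_add, add_zero, Fin.castSucc_lt_last, Fin.succ_pos,
    and_self, if_true, Finset.sum_mul]

/-- For a full cycle the sign of `muCoeff` is the one in `traceWord`. -/
lemma muExp_finRotate {r : ℕ} (b p : Fin (r + 1) → ZMod 2) :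
    muExp (finRotate (r + 1)) (fun t => b (t + 1)) b p
      = ∑ t : Fin r, b t.succ + ∑ t, p t * (b 0 + b t) := by
  have hsq : ∀ z : ZMod 2, z * z = z := by decide
  set a : Fin (r + 1) → ZMod 2 := fun t => b (t + 1) with ha
  have hbil : ∀ c, bil (b + a) c = ∑ t, c t * (b 0 + b t) := fun c => by
    rw [bil, Finset.sum_comm]
    refine Finset.sum_congr rfl fun t _ => ?_
    rw [← sum_lt_telescope, Finset.mul_sum]
    refine Finset.sum_congr rfl fun s _ => ?_
    split_ifs
    · simp only [Pi.add_apply, ha]; ring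
    · simp
  have hsum : ∑ t, a t = ∑ t, b t := by
    rw [← Equiv.sum_comp (finRotate (r + 1)) b]; simp [ha]
  have hswap := bil_swap a (b + a)
  rw [hbil] at hswap
  have hS : ∑ t, b t = b 0 + ∑ t : Fin r, b t.succ := Fin.sum_univ_succ b
  have hlast : a (Fin.last r) = b 0 := by simp [ha]
  have hcast : ∀ s : Fin r, a s.castSucc = b s.succ := fun s => by simp [ha]
  rw [muExp, hbil, inv_finRotate, hlast]
  simp only [hcast]
  simp only [Pi.add_apply, mul_add, Finset.sum_add_distrib, hsq, ← Finset.sum_mul, hsum, hS]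
    at hswap ⊢
  have key : ∀ B S X Y P P' : ZMod 2, B * B = B →
      X + ((B + S) * B + Y) + (Y + (B + S)) = B + S + (B + S) →
      S * B + X + (P * B + P') = S + (P * B + P') := by grind
  exact key _ _ _ _ _ _ (hsq _) hswap

variable {𝕜 : Type*} [Field 𝕜] {ι κ : Type*} [DecidableEq ι] [Fintype κ] [DecidableEq κ]
  (p : ι → ZMod 2) (q : κ → ZMod 2)

lemma traceMap_cyc {r : ℕ} (w : Fin (r + 1) → ι) :
    traceMap 𝕜 p q (cyc 𝕜 p w) = traceWord w := by
  have h1 : cyc 𝕜 p w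
    = ofFn 𝕜 p (r + 1) (avg 𝕜 p (r + 1) (basisTens 𝕜 w (finRotate (r + 1)))) := rfl
  have h2 : ∀ x : Fin (r + 1) → ι × κ × κ, cyc 𝕜 (glParity p q) x
    = ofFn 𝕜 _ (r + 1) (avg 𝕜 _ (r + 1) (basisTens 𝕜 x (finRotate (r + 1)))) := fun _ => rfl
  rw [h1, traceMap_avg, traceWord]
  simp only [h2, ← map_smul, ← map_sum]
  congr 2
  funext x σ
  rw [traceTens_apply]
  simp only [Finset.sum_apply, Pi.smul_apply, smul_eq_mul]
  by_cases hσ : σ = finRotate (r + 1)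
  swap
  · simp [basisTens, hσ]
  subst hσ
  rw [Finset.sum_eq_single (fun s => (x s).2.1), muCoeff_eq]
  · simp only [basisTens, and_true]
    by_cases hw : (fun s => (x s).1) = w
    · subst hw
      have h : (∀ s, (x (finRotate (r + 1) s)).2.1 = (x s).2.2)
          ↔ x = fun s => ((x s).1, (x s).2.1, (x (s + 1)).2.1) := by
        simp only [finRotate_apply]
        constructor
        · intro h; funext s; rw [h s]
        · intro h s; exact (congrArg (fun z => z.2.2) (congrFun h s)).symm
      by_cases hx : x = fun s => ((x s).1, (x s).2.1, (x (s + 1)).2.1)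
      · rw [if_pos (h.2 hx), if_pos hx, if_pos rfl, one_mul, mul_one]
        have h3 := h.2 hx
        simp only [finRotate_apply] at h3
        rw [← muExp_finRotate (fun t => q (x t).2.1) (fun t => p (x t).1)]
        simp only [h3]
      · rw [if_neg (fun h' => hx (h.1 h')), if_neg hx, mul_zero, mul_zero]
    · have : ¬ x = fun t => (w t, (x t).2.1, (x (t + 1)).2.1) := fun h => hw (by
        funext s; exact congrArg (fun z => z.1) (congrFun h s))
      simp [hw, this]
  · intro β _ hβ
    have : ¬ x = fun t => (w t, β t, β (t + 1)) := fun h => hβ (by rw [h])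
    simp [basisTens, this]
  · simp

variable (𝕜) in
lemma isTraceMap_traceMap : IsTraceMap (traceMap 𝕜 p q) :=
  ⟨traceMap_one p q, traceMap_mul p q, fun _ w => traceMap_cyc p q w⟩

lemma IsTraceMap.eq [CharZero 𝕜] [Fintype ι] {M M' : F 𝕜 p →ₗ[𝕜] F 𝕜 (glParity p q)}
    (h : IsTraceMap M) (h' : IsTraceMap M') : M = M' := by
  obtain ⟨h1, h2, h3⟩ := h
  obtain ⟨h1', h2', h3'⟩ := h'
  refine ext_of_cyc 𝕜 p (X := F 𝕜 (glParity p q)) M M' (h1.trans h1'.symm) fun r w f hf => ?_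
  rw [h2, h2', h3, h3', hf]

end cyc

/-! ### The Batalin-Vilkovisky operator -/

section erase

/-- A fixed first place does not contribute inversions. -/
lemma inv_cons {n : ℕ} (E : Equiv.Perm (Fin (n + 1))) (ρ : Equiv.Perm (Fin n)) (h0 : E 0 = 0)
    (hs : ∀ k, E (Fin.succ k) = (ρ k).succ) (c : Fin (n + 1) → ZMod 2) :
    inv E c c = inv ρ (fun s => c s.succ) (fun s => c s.succ) := by
  simp [inv, Fin.sum_univ_succ, h0, hs]

/-- Exchanging two tensor factors of the same parity produces the sign of that parity, whatever
stands between them. -/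
lemma inv_swap_zero {n : ℕ} (j : Fin n) (d : Fin (n + 1) → ZMod 2) (hd : d 0 = d j.succ) :
    inv (Equiv.swap 0 j.succ) d d = d 0 := by
  have hz : ∀ z : ZMod 2, z + z = 0 := by decide
  have hsq : ∀ z : ZMod 2, z * z = z := by decide
  have hsw : ∀ t : Fin n, Equiv.swap 0 j.succ t.succ = if t = j then 0 else t.succ := fun t => by
    split_ifs with h
    · rw [h, Equiv.swap_apply_right]
    · exact Equiv.swap_apply_of_ne_of_ne (Fin.succ_ne_zero t)
        (fun h' => h (Fin.succ_injective _ h'))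
  have hA : ∀ t : Fin n, ((if t = j then 0 else t.succ) < j.succ) ↔ t ≤ j := fun t => by
    split_ifs with h
    · simp [h]
    · rw [Fin.succ_lt_succ_iff]; exact ⟨le_of_lt, fun h' => lt_of_le_of_ne h' h⟩
  have hB : ∀ s t : Fin n, (s < t ∧ (if t = j then (0 : Fin (n + 1)) else t.succ)
      < if s = j then 0 else s.succ) ↔ (t = j ∧ s < j) := fun s t => by
    by_cases ht : t = j <;> by_cases hs : s = j
    · simp [ht, hs]
    · simp [ht, hs]
    · simp [ht, hs]
    · simp only [ht, hs, if_false, Fin.succ_lt_succ_iff, false_and, iff_false, not_and]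
      exact fun h => h.not_gt
  simp only [inv, Fin.sum_univ_succ, hsw, Equiv.swap_apply_left, false_and, if_false,
    Fin.succ_pos, true_and, hA, Fin.not_lt_zero, zero_add, Fin.succ_lt_succ_iff, hB]
  rw [← Finset.sum_add_distrib]
  have : ∀ s : Fin n, ((if s ≤ j then d 0 * d s.succ else 0)
      + ∑ t : Fin n, if t = j ∧ s < j then d s.succ * d t.succ else 0)
      = if s = j then d 0 else 0 := fun s => by
    rw [Finset.sum_eq_single j (fun t _ ht => if_neg fun h => ht h.1) (by simp)]
    rcases lt_trichotomy s j with h | h | h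
    · simp only [h, h.le, h.ne, if_true, if_false, and_self, ← hd]
      rw [mul_comm, hz]
    · subst h
      simp [← hd, hsq]
    · simp [h.not_ge, h.not_gt, h.ne']
  simp [this]

variable (𝕜 : Type*) [Field 𝕜] {κ : Type*} [DecidableEq κ] (q : κ → ZMod 2)

/-- The coefficient of the matrix units with rows `R` and columns `C` in the permutation `π` of
tensors, without the signs of `End(W)^{⊗ n} ≅ End(W^{⊗ n})`. -/
def matchSign {n : ℕ} (π : Equiv.Perm (Fin n)) (R C : Fin n → κ) : 𝕜 :=
  if ∀ s, R (π s) = C s then ksgn 𝕜 (inv π (q ∘ C) (q ∘ C)) else 0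

/-- Contracting the row and the column index at the place `0`, by the supertrace, erases `0` from
its cycle, unless `0` is fixed. -/
lemma sum_matchSign_cons [Fintype κ] {n : ℕ} (π : Equiv.Perm (Fin (n + 1))) (hπ : π 0 ≠ 0)
    (R C : Fin n → κ) :
    ∑ β, ksgn 𝕜 (q β) * matchSign 𝕜 q π (Fin.cons β R : Fin (n + 1) → κ) (Fin.cons β C)
      = matchSign 𝕜 q (Equiv.Perm.decomposeFin π).2 R C := by
  obtain ⟨j, hj⟩ := Fin.exists_succ_eq.2 hπ
  set ρ := (Equiv.Perm.decomposeFin π).2 with hρ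
  set E := Equiv.Perm.decomposeFin.symm (0, ρ) with hE
  have hE0 : E 0 = 0 := Equiv.Perm.decomposeFin_symm_apply_zero _ _
  have hEs : ∀ k : Fin n, E k.succ = (ρ k).succ := fun k => by
    rw [hE, Equiv.Perm.decomposeFin_symm_apply_succ]; simp
  have hπ0 : (Equiv.Perm.decomposeFin π).1 = π 0 := by
    conv_rhs => rw [← Equiv.Perm.decomposeFin.symm_apply_apply π]
    exact (Equiv.Perm.decomposeFin_symm_apply_zero _ _).symm
  have hdec : π = Equiv.Perm.decomposeFin.symm (j.succ, ρ) := by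
    rw [hj, ← hπ0, hρ]; exact (Equiv.Perm.decomposeFin.symm_apply_apply π).symm
  have hπs : ∀ k : Fin n, π k.succ = Equiv.swap 0 j.succ (ρ k).succ := fun k => by
    conv_lhs => rw [hdec]
    exact Equiv.Perm.decomposeFin_symm_apply_succ _ _ _
  have hπE : π = Equiv.swap 0 j.succ * E := by
    ext s
    refine Fin.cases ?_ (fun k => ?_) s
    · simp [hE0, ← hj]
    · simp [hEs, hπs]
  have hmatch : ∀ β, (∀ s, (Fin.cons β R : Fin (n + 1) → κ) (π s) = (Fin.cons β C : _ → κ) s)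
      ↔ β = R j ∧ ∀ s, R (ρ s) = C s := fun β => by
    rw [Fin.forall_fin_succ]
    simp only [← hj, hπs, Fin.cons_succ, Fin.cons_zero, eq_comm (a := R j)]
    refine and_congr_right fun hβ => forall_congr' fun s => ?_
    by_cases h : ρ s = j
    · rw [h, Equiv.swap_apply_right, Fin.cons_zero, hβ]
    · rw [Equiv.swap_apply_of_ne_of_ne (Fin.succ_ne_zero _)
        (fun h' => h (Fin.succ_injective _ h')), Fin.cons_succ]
  rw [Finset.sum_eq_single (R j)]
  · simp only [matchSign, hmatch, true_and]
    split_ifs with hc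
    · rw [← ksgn_add]
      congr 1
      set c : Fin (n + 1) → ZMod 2 := q ∘ (Fin.cons (R j) C : Fin (n + 1) → κ) with hcdef
      have hcs : (fun s : Fin n => c s.succ) = q ∘ C := by funext s; simp [hcdef]
      have h1 := inv_mul (Equiv.swap 0 j.succ) E (c ∘ E.symm ∘ Equiv.swap 0 j.succ)
      have e1 : (c ∘ E.symm ∘ Equiv.swap 0 j.succ) ∘ Equiv.swap 0 j.succ ∘ E = c := by
        funext s; simp
      have e2 : (c ∘ E.symm ∘ Equiv.swap 0 j.succ) ∘ Equiv.swap 0 j.succ = c ∘ E.symm := by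
        funext s; simp
      have e3 : E.symm 0 = 0 := by rw [Equiv.symm_apply_eq, hE0]
      have e4 : E.symm j.succ = (ρ.symm j).succ := by rw [Equiv.symm_apply_eq, hEs]; simp
      have e5 : C (ρ.symm j) = R j := by rw [← hc]; simp
      rw [e1, e2, ← hπE, inv_swap_zero, inv_cons E ρ hE0 hEs, hcs] at h1
      · rw [h1]
        simp only [Function.comp_apply, e3, hcdef, Fin.cons_zero]
        rw [← add_assoc, CharTwo.add_self_eq_zero, zero_add]
      · simp only [Function.comp_apply, e3, e4, hcdef, Fin.cons_zero, Fin.cons_succ, e5]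
    · simp
  · intro β _ hβ
    simp [matchSign, hmatch, hβ]
  · simp

/-- Exchanging the first two columns, as the dissection-gluing does, costs the Koszul sign of these
two. -/
lemma matchSign_mul_swap {n : ℕ} (σ : Equiv.Perm (Fin (n + 2))) (R C : Fin n → κ) (α β : κ) :
    matchSign 𝕜 q σ (Fin.cons β (Fin.cons α R : Fin (n + 1) → κ))
        (Fin.cons α (Fin.cons β C : Fin (n + 1) → κ))
      = ksgn 𝕜 (q α * q β) * matchSign 𝕜 q (σ * Equiv.swap 0 1)
          (Fin.cons β (Fin.cons α R : Fin (n + 1) → κ))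
          (Fin.cons β (Fin.cons α C : Fin (n + 1) → κ)) := by
  set R' : Fin (n + 2) → κ := Fin.cons β (Fin.cons α R : Fin (n + 1) → κ)
  set C₁ : Fin (n + 2) → κ := Fin.cons α (Fin.cons β C : Fin (n + 1) → κ) with hC₁
  set C₂ : Fin (n + 2) → κ := Fin.cons β (Fin.cons α C : Fin (n + 1) → κ) with hC₂
  have hC : C₁ ∘ Equiv.swap 0 1 = C₂ := by
    funext s
    refine Fin.cases ?_ (fun s => Fin.cases ?_ (fun s => ?_) s) s
    · rw [Function.comp_apply, Equiv.swap_apply_left]; rfl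
    · rw [Function.comp_apply, Fin.succ_zero_eq_one, Equiv.swap_apply_right]; rfl
    · have h1 : s.succ.succ ≠ 1 := by
        rw [← Fin.succ_zero_eq_one]; exact fun h => Fin.succ_ne_zero _ (Fin.succ_injective _ h)
      rw [Function.comp_apply, Equiv.swap_apply_of_ne_of_ne (Fin.succ_ne_zero _) h1]
      simp [hC₁, hC₂]
  have hmatch : (∀ s, R' ((σ * Equiv.swap 0 1 : Equiv.Perm (Fin (n + 2))) s) = C₂ s)
      ↔ ∀ s, R' (σ s) = C₁ s := by
    rw [← (Equiv.swap (0 : Fin (n + 2)) 1).forall_congr_right (q := fun s => R' (σ s) = C₁ s)]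
    simp [← hC]
  unfold matchSign
  rw [if_congr hmatch rfl rfl]
  split_ifs with hc
  · rw [← ksgn_add]
    congr 1
    have h := inv_mul σ (Equiv.swap 0 1) (q ∘ R')
    have e1 : (q ∘ R') ∘ σ = q ∘ C₁ := by funext s; simp [hc]
    have e2 : (q ∘ R') ∘ σ ∘ Equiv.swap 0 1 = q ∘ C₂ := by
      rw [← hC]; funext s; simp [hc]
    rw [e1, e2] at h
    have hsw : inv (Equiv.swap (0 : Fin (n + 2)) 1) (q ∘ C₂) (q ∘ C₂) = q α * q β := by
      have h1 : ∀ s : Fin n, Equiv.swap (0 : Fin (n + 2)) 1 s.succ.succ = s.succ.succ := fun s => by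
        refine Equiv.swap_apply_of_ne_of_ne (Fin.succ_ne_zero _) ?_
        rw [← Fin.succ_zero_eq_one]
        exact fun h => Fin.succ_ne_zero _ (Fin.succ_injective _ h)
      have h3 : ∀ s : Fin n, ¬ s.succ.succ < (1 : Fin (n + 2)) := fun s => by
        rw [Fin.lt_def]; simp
      have h4 : ∀ s t : Fin n, ¬ (s < t ∧ t < s) := fun s t h => h.1.not_gt h.2
      simp [inv, Fin.sum_univ_succ, h1, h3, h4, hC₂, mul_comm]
    rw [h, hsw]
    have hz : ∀ z : ZMod 2, z + z = 0 := by decide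
    linear_combination -hz (q α * q β)
  · simp

end erase

section contraction

variable {𝕜 : Type*} [Field 𝕜] {ι κ : Type*} [DecidableEq κ] (p : ι → ZMod 2) (q : κ → ZMod 2)

lemma bil_cons {n : ℕ} (a b : Fin n → ZMod 2) (x y : ZMod 2) :
    bil (Fin.cons x a : Fin (n + 1) → ZMod 2) (Fin.cons y b) = x * ∑ t, b t + bil a b := by
  simp [bil, Fin.sum_univ_succ, Finset.mul_sum]

lemma muCoeff_eq_matchSign {n : ℕ} (σ : Equiv.Perm (Fin n)) (i : Fin n → ι) (R C : Fin n → κ) :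
    muCoeff 𝕜 p q σ (fun s => (i s, R s, C s)) = matchSign 𝕜 q σ R C *
      ksgn 𝕜 (bil (q ∘ C) (q ∘ R + q ∘ C) + bil (q ∘ R + q ∘ C) (p ∘ i)) := by
  rw [muCoeff_eq, matchSign]
  split_ifs
  · rw [muExp, add_assoc, ksgn_add]; rfl
  · simp

/-- The supertrace contraction of the first two matrix units of a permutation of tensors, followed
by the dissection-gluing. -/
lemma sum_muCoeff_cons [Fintype κ] {n : ℕ} (σ : Equiv.Perm (Fin (n + 2)))
    (hσ : ¬ HasEmptyCycle σ) (i j : ι) (v : Fin n → ι × κ × κ) :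
    ∑ α, ∑ β, ksgn 𝕜 ((q β + q α) * p j) * ksgn 𝕜 (q β) *
      muCoeff 𝕜 p q σ (Fin.cons (i, β, α) (Fin.cons (j, α, β) v : Fin (n + 1) → ι × κ × κ))
      = muCoeff 𝕜 p q (cutGlue σ) v := by
  set V : Fin n → ι := fun s => (v s).1 with hV
  set R : Fin n → κ := fun s => (v s).2.1 with hR
  set C : Fin n → κ := fun s => (v s).2.2 with hC
  set π := σ * Equiv.swap 0 1 with hπ
  set ρ := (Equiv.Perm.decomposeFin π).2 with hρ
  have hcut : cutGlue σ = (Equiv.Perm.decomposeFin ρ).2 := rfl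
  simp only [HasEmptyCycle, not_or, not_and] at hσ
  obtain ⟨hσ1, hσ2, hσ3⟩ := hσ
  have hπ0 : π 0 = σ 1 := by simp [hπ]
  have hπ1 : π 1 = σ 0 := by simp [hπ]
  have hρ0 : ρ 0 ≠ 0 := by
    intro h
    have h1 : (Equiv.Perm.decomposeFin π).1 = π 0 := by
      conv_rhs => rw [← Equiv.Perm.decomposeFin.symm_apply_apply π]
      exact (Equiv.Perm.decomposeFin_symm_apply_zero _ _).symm
    have h2 : π 1 = Equiv.swap 0 (π 0) (ρ 0).succ := by
      conv_lhs => rw [← Equiv.Perm.decomposeFin.symm_apply_apply π]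
      rw [← Fin.succ_zero_eq_one, ← h1]
      exact Equiv.Perm.decomposeFin_symm_apply_succ _ _ _
    rw [h, Fin.succ_zero_eq_one, hπ0, hπ1] at h2
    by_cases h3 : σ 1 = 1
    · rw [h3, Equiv.swap_apply_right] at h2
      exact hσ3 h2 h3
    · rw [Equiv.swap_apply_of_ne_of_ne one_ne_zero (Ne.symm h3)] at h2
      exact hσ1 h2
  set e : 𝕜 := ksgn 𝕜 (bil (q ∘ C) (q ∘ R + q ∘ C) + bil (q ∘ R + q ∘ C) (p ∘ V)) with he
  have hx : ∀ α β, (Fin.cons (i, β, α) (Fin.cons (j, α, β) v : Fin (n + 1) → ι × κ × κ) :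
      Fin (n + 2) → ι × κ × κ) = fun s =>
        ((Fin.cons i (Fin.cons j V : Fin (n + 1) → ι) : Fin (n + 2) → ι) s,
          (Fin.cons β (Fin.cons α R : Fin (n + 1) → κ) : Fin (n + 2) → κ) s,
          (Fin.cons α (Fin.cons β C : Fin (n + 1) → κ) : Fin (n + 2) → κ) s) := fun α β => by
    funext s
    refine Fin.cases ?_ (fun s => Fin.cases ?_ (fun s => ?_) s) s <;> simp [hV, hR, hC]
  have hterm : ∀ α β, ksgn 𝕜 ((q β + q α) * p j) * ksgn 𝕜 (q β) *
      muCoeff 𝕜 p q σ (Fin.cons (i, β, α) (Fin.cons (j, α, β) v : Fin (n + 1) → ι × κ × κ))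
      = ksgn 𝕜 (q α) * (ksgn 𝕜 (q β) * matchSign 𝕜 q π
          (Fin.cons β (Fin.cons α R : Fin (n + 1) → κ))
          (Fin.cons β (Fin.cons α C : Fin (n + 1) → κ))) * e := fun α β => by
    rw [hx, muCoeff_eq_matchSign, matchSign_mul_swap, ← hπ]
    set m := matchSign 𝕜 q π (Fin.cons β (Fin.cons α R : Fin (n + 1) → κ))
          (Fin.cons β (Fin.cons α C : Fin (n + 1) → κ)) with hm
    by_cases hm0 : m = 0
    · simp [hm0]
    -- the rows and the columns have the same total parity
    have hD : ∑ s, (q (R s) + q (C s)) = 0 := by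
      have h1 : ∀ s, (Fin.cons β (Fin.cons α R : Fin (n + 1) → κ) : Fin (n + 2) → κ) (π s)
          = (Fin.cons β (Fin.cons α C : Fin (n + 1) → κ) : Fin (n + 2) → κ) s := by
        by_contra h
        exact hm0 (if_neg h)
      have h2 := Equiv.sum_comp π
        (fun s => q ((Fin.cons β (Fin.cons α R : Fin (n + 1) → κ) : Fin (n + 2) → κ) s))
      simp only [h1, Fin.sum_univ_succ, Fin.cons_zero, Fin.cons_succ, add_right_inj] at h2
      rw [Finset.sum_add_distrib, h2, CharTwo.add_self_eq_zero]
    have c1 : ∀ (x y : κ) (S : Fin n → κ), q ∘ (Fin.cons x (Fin.cons y S : Fin (n + 1) → κ) :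
        Fin (n + 2) → κ) = Fin.cons (q x) (Fin.cons (q y) (q ∘ S) : Fin (n + 1) → ZMod 2) := by
      intro x y S
      funext s
      refine Fin.cases ?_ (fun s => Fin.cases ?_ (fun s => ?_) s) s <;> simp
    have c2 : p ∘ (Fin.cons i (Fin.cons j V : Fin (n + 1) → ι) :
        Fin (n + 2) → ι) = Fin.cons (p i) (Fin.cons (p j) (p ∘ V) : Fin (n + 1) → ZMod 2) := by
      funext s
      refine Fin.cases ?_ (fun s => Fin.cases ?_ (fun s => ?_) s) s <;> simp
    have c3 : (Fin.cons (q β) (Fin.cons (q α) (q ∘ R) : Fin (n + 1) → ZMod 2) :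
        Fin (n + 2) → ZMod 2) + Fin.cons (q α) (Fin.cons (q β) (q ∘ C) : Fin (n + 1) → ZMod 2)
        = Fin.cons (q β + q α) (Fin.cons (q α + q β) (q ∘ R + q ∘ C) : Fin (n + 1) → ZMod 2) := by
      funext s
      refine Fin.cases ?_ (fun s => Fin.cases ?_ (fun s => ?_) s) s <;> simp
    simp only [c1, c2, c3, bil_cons, Fin.sum_univ_succ, Fin.cons_zero, Fin.cons_succ,
      Pi.add_apply, Function.comp_apply, hD]
    rw [he]
    have key : ∀ a b P s X Y : ZMod 2, (b + a) * P + b + a * b +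
        (a * (a + b + 0) + (b * 0 + X) + ((b + a) * (P + s) + ((a + b) * s + Y)))
        = a + b + (X + Y) := by
      have hsq : ∀ z : ZMod 2, z * z = z := by decide
      intro a b P s X Y
      have h2 : (2 : ZMod 2) = 0 := rfl
      linear_combination hsq a + (a * b + b * P + a * P + a * s + b * s) * h2
    have := congrArg (ksgn 𝕜) (key (q α) (q β) (p j) (∑ t, p (V t))
      (bil (q ∘ C) (q ∘ R + q ∘ C)) (bil (q ∘ R + q ∘ C) (p ∘ V)))
    rw [ksgn_add 𝕜 ((q β + q α) * p j + q β + q α * q β), ksgn_add 𝕜 ((q β + q α) * p j + q β),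
      ksgn_add 𝕜 ((q β + q α) * p j), ksgn_add 𝕜 (q α + q β), ksgn_add 𝕜 (q α) (q β)] at this
    linear_combination m * this
  simp only [hterm, ← Finset.sum_mul, ← Finset.mul_sum]
  have h1 : ∀ α, ∑ β, ksgn 𝕜 (q β) * matchSign 𝕜 q π
          (Fin.cons β (Fin.cons α R : Fin (n + 1) → κ))
          (Fin.cons β (Fin.cons α C : Fin (n + 1) → κ))
      = matchSign 𝕜 q ρ (Fin.cons α R : Fin (n + 1) → κ) (Fin.cons α C) := fun α =>
    sum_matchSign_cons 𝕜 q π (by rw [hπ0]; exact hσ2) _ _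
  simp only [h1]
  rw [sum_matchSign_cons 𝕜 q ρ hρ0, he, ← muCoeff_eq_matchSign, hcut]

variable [Fintype ι] [Fintype κ] {p}

lemma sum_pair_comm {A B S X : Type*} [Fintype A] [Fintype B] [Fintype S] [AddCommMonoid X]
    (f : A × B → A × B → S → X) :
    ∑ x, ∑ y, ∑ s, f x y s = ∑ i, ∑ j, ∑ s, ∑ a, ∑ b, f (i, a) (j, b) s := by
  rw [Fintype.sum_prod_type]
  refine Finset.sum_congr rfl fun i _ => ?_
  simp only [Fintype.sum_prod_type]
  rw [Finset.sum_comm]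
  refine Finset.sum_congr rfl fun j _ => ?_
  exact (Finset.sum_congr rfl fun a _ => Finset.sum_comm).trans Finset.sum_comm

/-- The trace map commutes with contraction and dissection-gluing. -/
lemma contract_traceTens (l : OddScalarProduct 𝕜 p) {n : ℕ} (c : Tens 𝕜 ι (n + 2)) :
    contract (l.tensorGl q) n (traceTens 𝕜 p q (n + 2) c)
      = traceTens 𝕜 p q n (contract l n c) := by
  funext v τ
  rw [traceTens_apply]
  change (∑ x, ∑ y, ∑ σ : Equiv.Perm (Fin (n + 2)), if ¬ HasEmptyCycle σ ∧ cutGlue σ = τ then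
      (l.tensorGl q).form x y * (c _ σ * muCoeff 𝕜 p q σ _) else 0)
    = (∑ i, ∑ j, ∑ σ : Equiv.Perm (Fin (n + 2)), if ¬ HasEmptyCycle σ ∧ cutGlue σ = τ then
      l.form i j * c _ σ else 0) * _
  rw [sum_pair_comm]
  simp only [Finset.sum_mul]
  refine Finset.sum_congr rfl fun i _ => Finset.sum_congr rfl fun j _ =>
    Finset.sum_congr rfl fun σ _ => ?_
  split_ifs with hσ
  swap
  · simp
  obtain ⟨hσ, rfl⟩ := hσ
  have hi : ∀ a b : κ × κ, (fun s => ((Fin.cons (i, a) (Fin.cons (j, b) v :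
      Fin (n + 1) → ι × κ × κ) : Fin (n + 2) → ι × κ × κ) s).1)
      = Fin.cons i (Fin.cons j fun s => (v s).1 : Fin (n + 1) → ι) := fun a b => by
    funext s
    refine Fin.cases ?_ (fun s => Fin.cases ?_ (fun s => ?_) s) s <;> simp
  simp only [hi]
  rw [← sum_muCoeff_cons p q σ hσ i j v, Finset.mul_sum, Fintype.sum_prod_type, Finset.sum_comm]
  refine Finset.sum_congr rfl fun α _ => ?_
  rw [Finset.mul_sum]
  refine Finset.sum_congr rfl fun β _ => ?_
  rw [Finset.sum_eq_single (α, β)]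
  · simp only [OddScalarProduct.tensorGl, strForm, and_self, if_true]
    ring
  · rintro ⟨γ, δ⟩ - h
    have : ¬ (α = γ ∧ β = δ) := fun h' => h (by rw [h'.1, h'.2])
    simp [OddScalarProduct.tensorGl, strForm, this]
  · simp

lemma Delta_ofFn (l : OddScalarProduct 𝕜 p) {n : ℕ} (c : Fn 𝕜 p (n + 2)) :
    Delta l (ofFn 𝕜 p (n + 2) c)
      = ((n + 2).choose 2 : 𝕜) • ofFn 𝕜 p n (avg 𝕜 p n (contract l n c)) := by
  rw [Delta, ofFn, DirectSum.toModule_lof]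
  rfl

lemma Delta_ofFn_zero (l : OddScalarProduct 𝕜 p) (c : Fn 𝕜 p 0) :
    Delta l (ofFn 𝕜 p 0 c) = 0 := by
  rw [Delta, ofFn, DirectSum.toModule_lof]
  rfl

lemma Delta_ofFn_one (l : OddScalarProduct 𝕜 p) (c : Fn 𝕜 p 1) :
    Delta l (ofFn 𝕜 p 1 c) = 0 := by
  rw [Delta, ofFn, DirectSum.toModule_lof]
  rfl

lemma traceMap_Delta (l : OddScalarProduct 𝕜 p) (f : F 𝕜 p) :
    traceMap 𝕜 p q (Delta l f) = Delta (l.tensorGl q) (traceMap 𝕜 p q f) := by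
  induction f using ofFn_induction with
  | h0 => simp
  | hadd f g hf hg => simp only [map_add, hf, hg]
  | hof n c =>
    rw [traceMap_ofFn]
    match n, c with
    | 0, c => rw [Delta_ofFn_zero, Delta_ofFn_zero, map_zero]
    | 1, c => rw [Delta_ofFn_one, Delta_ofFn_one, map_zero]
    | n + 2, c =>
      rw [Delta_ofFn, Delta_ofFn, map_smul, traceMap_avg, ← contract_traceTens]
      rfl

lemma traceMap_bracket (l : OddScalarProduct 𝕜 p) (f g : F 𝕜 p) :
    traceMap 𝕜 p q (bracket l f g)
      = bracket (l.tensorGl q) (traceMap 𝕜 p q f) (traceMap 𝕜 p q g) := by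
  simp only [bracket, map_sub, traceMap_Delta, traceMap_mul, traceMap_parityOp]

/-- The left hand side of the quantum master equation commutes with the trace map. -/
lemma traceMap_masterEquation (l : OddScalarProduct 𝕜 p) (S : ℕ → F 𝕜 p) (m : ℕ) :
    traceMap 𝕜 p q (hbarDelta l S m + (2 : 𝕜)⁻¹ •
        ∑ ab ∈ Finset.HasAntidiagonal.antidiagonal m, bracket l (S ab.1) (S ab.2))
      = hbarDelta (l.tensorGl q) (fun a => traceMap 𝕜 p q (S a)) m + (2 : 𝕜)⁻¹ •
        ∑ ab ∈ Finset.HasAntidiagonal.antidiagonal m,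
          bracket (l.tensorGl q) (traceMap 𝕜 p q (S ab.1)) (traceMap 𝕜 p q (S ab.2)) := by
  have h : traceMap 𝕜 p q (hbarDelta l S m)
      = hbarDelta (l.tensorGl q) (fun a => traceMap 𝕜 p q (S a)) m := by
    cases m with
    | zero => exact map_zero _
    | succ m => exact traceMap_Delta q l _
  simp only [map_add, map_smul, map_sum, h, traceMap_bracket]

lemma isSolution_traceMap (l : OddScalarProduct 𝕜 p) {S : ℕ → F 𝕜 p} (hS : IsSolution l S) :
    IsSolution (l.tensorGl q) (fun a => traceMap 𝕜 p q (S a)) :=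
  ⟨fun a => isEven_traceMap p q (hS.1 a), fun m => by
    rw [← traceMap_masterEquation, hS.2 m, map_zero]⟩

lemma isSolution_of_traceMap [Nonempty κ] (l : OddScalarProduct 𝕜 p) {S : ℕ → F 𝕜 p}
    (hS : IsSolution (l.tensorGl q) (fun a => traceMap 𝕜 p q (S a))) : IsSolution l S :=
  ⟨fun a => isEven_of_traceMap p q (hS.1 a), fun m => traceMap_injective p q (by
    rw [traceMap_masterEquation, hS.2 m, map_zero])⟩

end contraction

/-! ### Invariance of permutations of tensors -/

section invariance

lemma bil_single {n : ℕ} (c : Fin n → ZMod 2) (s : Fin n) (g : ZMod 2) :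
    bil c (Pi.single s g) = g * ∑ t, if t < s then c t else 0 := by
  rw [bil, Finset.mul_sum]
  refine Finset.sum_congr rfl fun t _ => ?_
  rw [Finset.sum_eq_single s]
  · simp [mul_comm]
  · intro r _ hr; simp [hr]
  · simp

/-- The change of the sign of `muCoeff` when one entry of the row indices and the corresponding
entry of the column indices change their parity by `g`. -/
lemma muExp_add_single {n : ℕ} (σ : Equiv.Perm (Fin n)) (a b p : Fin n → ZMod 2)
    (h : ∀ t, b (σ t) = a t) (s : Fin n) (g : ZMod 2) :
    g * ((∑ t, if t < σ s then (p + (b + Pi.single (σ s) g) + a : Fin n → ZMod 2) t else 0)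
          + p (σ s))
        + muExp σ a b p
      = g * ((∑ t, if t < s then (p + (b + Pi.single (σ s) g) + a : Fin n → ZMod 2) t else 0) + p s)
        + (g * ((b + Pi.single (σ s) g : Fin n → ZMod 2) s + (a s + g))
          + muExp σ (a + Pi.single s g) (b + Pi.single (σ s) g) p) := by
  have hsq : g * g = g := by revert g; decide
  set e : Fin n → ZMod 2 := Pi.single (σ s) g with he
  set e' : Fin n → ZMod 2 := Pi.single s g with he'
  have hee : e ∘ σ = e' := by
    funext t
    by_cases ht : t = s
    · subst ht; simp [he, he']
    · simp [he, he', ht]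
  have hba : b ∘ σ = a := funext h
  have h1 := bil_perm σ b e
  rw [hba, hee] at h1
  have h2 := bil_swap e p
  have h3 := bil_swap e' p
  have h4 := bil_swap e' b
  have h5 := bil_swap e' a
  have h6 := bil_swap e' e
  have s1 : ∑ t, e t = g := by simp [he]
  have s2 : ∑ t, e' t = g := by simp [he']
  have s3 : ∀ c : Fin n → ZMod 2, ∑ t, e t * c t = g * c (σ s) := fun c => by
    rw [Finset.sum_eq_single (σ s) (fun t _ ht => by simp [he, ht]) (by simp)]; simp [he]
  have s4 : ∀ c : Fin n → ZMod 2, ∑ t, e' t * c t = g * c s := fun c => by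
    rw [Finset.sum_eq_single s (fun t _ ht => by simp [he', ht]) (by simp)]; simp [he']
  have s5 : ∑ t, b t = ∑ t, a t := by rw [← Equiv.sum_comp σ]; simp [h]
  have z : ∀ r : Fin n, bil (Pi.single r g) (Pi.single r g) = 0 := fun r => by
    refine Finset.sum_eq_zero fun t _ => Finset.sum_eq_zero fun t' _ => ?_
    by_cases ht : t = r <;> by_cases ht' : t' = r <;> simp [ht, ht']
  have z1 : bil e e = 0 := z _
  have z2 : bil e' e' = 0 := z _
  have z3 : inv σ e' e' = 0 := by
    refine Finset.sum_eq_zero fun t _ => Finset.sum_eq_zero fun r _ => ?_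
    by_cases ht : t = s <;> by_cases hr : r = s <;> simp [he', ht, hr]
  rw [mul_add, mul_add g (∑ t, _) (p s), he, ← bil_single, ← he]
  have hb' : ∀ c, g * (∑ t, if t < s then c t else 0) = bil c e' := fun c => (bil_single c s g).symm
  rw [hb']
  simp only [s1, s2, s3, s4, s5] at h2 h3 h4 h5 h6
  simp only [muExp, bil_add_left, bil_add_right, inv_add_left, inv_add_right, z1, z2, z3,
    Pi.add_apply]
  clear_value e e'
  clear hb' s3 s4 s5 h
  grind

variable {𝕜 : Type*} [Field 𝕜] {ι υ : Type*} [DecidableEq υ] (p : ι → ZMod 2) (u : υ → ZMod 2)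

/-- The function on `(V ⊗ End U)^{⊗ n}` that `muF` attaches to an invariant tensor, defined for all
tensors. -/
def muTens {n : ℕ} (c : Tens 𝕜 ι n) : (Fin n → ι × υ × υ) → 𝕜 :=
  fun x => ∑ σ : Equiv.Perm (Fin n), c (fun s => (x s).1) σ * muCoeff 𝕜 p u σ x

/-- The two terms in which a matrix `G` meets the row index at `σ s` and the column index at `s`
agree. -/
lemma glAct_muCoeff_term [Fintype υ] {n : ℕ} (σ : Equiv.Perm (Fin n)) (g : ZMod 2)
    (G : Matrix υ υ 𝕜) (hG : ∀ β α, G β α ≠ 0 → u β + u α = g) (x : Fin n → ι × υ × υ)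
    (s : Fin n) :
    ksgn 𝕜 (g * ((∑ t : Fin n, if t < σ s then glParity p u (x t) else 0) + p (x (σ s)).1)) *
      ∑ γ : υ, G (x (σ s)).2.1 γ *
        muCoeff 𝕜 p u σ (Function.update x (σ s) ((x (σ s)).1, γ, (x (σ s)).2.2))
    = ksgn 𝕜 (g * ((∑ t : Fin n, if t < s then glParity p u (x t) else 0) + p (x s).1)) *
      ∑ γ : υ, ksgn 𝕜 (g * (u (x s).2.1 + u γ)) *
        (muCoeff 𝕜 p u σ (Function.update x s ((x s).1, (x s).2.1, γ)) * G γ (x s).2.2) := by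
  set A := (x s).2.2 with hA
  set B := (x (σ s)).2.1 with hB
  set x₁ := Function.update x (σ s) ((x (σ s)).1, A, (x (σ s)).2.2) with hx₁
  set x₂ := Function.update x s ((x s).1, (x s).2.1, B) with hx₂
  have r1 : ∀ γ t, ((Function.update x (σ s) ((x (σ s)).1, γ, (x (σ s)).2.2)) t).2.2
      = (x t).2.2 := fun γ t => by
    by_cases h : t = σ s
    · subst h; simp
    · simp [h]
  have r2 : ∀ γ t, ((Function.update x s ((x s).1, (x s).2.1, γ)) t).2.1 = (x t).2.1 :=
      fun γ t => by
    by_cases h : t = s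
    · subst h; simp
    · simp [h]
  have r3 : ∀ t, (x₁ t).1 = (x t).1 := fun t => by
    by_cases h : t = σ s
    · subst h; simp [hx₁]
    · simp [hx₁, h]
  have r4 : ∀ t, (x₂ t).1 = (x t).1 := fun t => by
    by_cases h : t = s
    · subst h; simp [hx₂]
    · simp [hx₂, h]
  rw [Finset.sum_eq_single A, Finset.sum_eq_single B]
  rotate_left
  · intro γ _ hγ
    rw [muCoeff_eq, if_neg, zero_mul, mul_zero]
    intro h
    have := h s
    rw [r2] at this
    simp only [Function.update_self] at this
    exact hγ this.symm
  · simp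
  · intro γ _ hγ
    rw [muCoeff_eq, if_neg, mul_zero]
    intro h
    have := h s
    rw [r1] at this
    simp only [Function.update_self] at this
    exact hγ this
  · simp
  by_cases hG0 : G B A = 0
  · simp [hG0]
  have hg := hG _ _ hG0
  rw [← hx₁, ← hx₂, muCoeff_eq, muCoeff_eq]
  have hm : (∀ t, (x₁ (σ t)).2.1 = (x₁ t).2.2) ↔ ∀ t, (x₂ (σ t)).2.1 = (x₂ t).2.2 := by
    refine forall_congr' fun t => ?_
    rw [hx₁, r1, ← hx₁, hx₂, r2]
    by_cases h : t = s
    · subst h; simp [hx₁, hA, hB]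
    · simp [hx₁, h]
  rw [if_congr hm rfl rfl]
  split_ifs with hc
  swap
  · simp
  have h₁ := hm.2 hc
  set b : Fin n → ZMod 2 := fun t => u (x₁ t).2.1 with hb
  set a : Fin n → ZMod 2 := fun t => u (x t).2.2 with ha
  set P : Fin n → ZMod 2 := fun t => p (x t).1 with hP
  have hz : ∀ z : ZMod 2, z + z = 0 := by decide
  have hrow : (fun t => u (x t).2.1) = b + Pi.single (σ s) g := by
    funext t
    by_cases h : t = σ s
    · subst h
      simp only [Pi.add_apply, Pi.single_eq_same, hb, hx₁, Function.update_self]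
      rw [← hB, ← hg]
      linear_combination -hz (u A)
    · simp [hb, hx₁, h]
  have hcol : (fun t => u (x₂ t).2.2) = a + Pi.single s g := by
    funext t
    by_cases h : t = s
    · subst h
      simp only [Pi.add_apply, Pi.single_eq_same, ha, hx₂, Function.update_self]
      rw [← hA, ← hg]
      linear_combination -hz (u A)
    · simp [ha, hx₂, h]
  have e1 : (fun t => u (x₁ t).2.2) = a := by funext t; rw [hx₁, r1]
  have e2 : (fun t => u (x₂ t).2.1) = b + Pi.single (σ s) g := by
    rw [← hrow]; funext t; rw [hx₂, r2]
  have e3 : (fun t => p (x₁ t).1) = P := by funext t; rw [r3]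
  have e4 : (fun t => p (x₂ t).1) = P := by funext t; rw [r4]
  have e5 : ∀ t, glParity p u (x t) = (P + (b + Pi.single (σ s) g) + a : Fin n → ZMod 2) t :=
      fun t => by
    rw [← hrow]; rfl
  have e6 : u (x s).2.1 = (b + Pi.single (σ s) g : Fin n → ZMod 2) s := by rw [← hrow]
  have e7 : u B = a s + g := by
    rw [← hg]; change _ = u A + _; linear_combination -hz (u A)
  simp only [e5]
  rw [e1, e2, e3, e4, hcol, e6, e7]
  have key := congrArg (ksgn 𝕜) (muExp_add_single σ a b P (fun t => by
    have := congrArg u (h₁ t); rw [hx₁, r1] at this; exact this) s g)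
  rw [ksgn_add, ksgn_add, ksgn_add 𝕜 (g * (_ + (a s + g)))] at key
  change ksgn 𝕜 (g * (_ + P (σ s))) * _ = ksgn 𝕜 (g * (_ + P s)) * _
  linear_combination G B A * key

lemma isGlInvariant_muTens [Fintype υ] {n : ℕ} (c : Tens 𝕜 ι n) :
    IsGlInvariant p u (muTens p u c) := by
  intro g G hG
  funext x
  have hfst : ∀ s (y : υ × υ), (fun t => (Function.update x s ((x s).1, y) t).1)
      = fun t => (x t).1 := fun s y => by
    funext t
    by_cases h : t = s
    · subst h; simp
    · simp [h]
  set A : Fin n → 𝕜 := fun s =>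
    ksgn 𝕜 (g * ((∑ t : Fin n, if t < s then glParity p u (x t) else 0) + p (x s).1)) with hA
  have h1 : glAct p u g G (muTens p u c) x = ∑ σ : Equiv.Perm (Fin n), c (fun t => (x t).1) σ *
      (∑ s, A s * ∑ γ : υ, G (x s).2.1 γ *
          muCoeff 𝕜 p u σ (Function.update x s ((x s).1, γ, (x s).2.2))
        - ∑ s, A s * ∑ γ : υ, ksgn 𝕜 (g * (u (x s).2.1 + u γ)) *
          (muCoeff 𝕜 p u σ (Function.update x s ((x s).1, (x s).2.1, γ)) * G γ (x s).2.2)) := by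
    simp only [glAct, muTens, hfst]
    simp only [hA, Finset.mul_sum, Finset.sum_mul, mul_sub, Finset.sum_sub_distrib]
    congr 1
    all_goals
      refine Eq.trans ?_ Finset.sum_comm
      refine Finset.sum_congr rfl fun s _ => Eq.trans ?_ Finset.sum_comm
      refine Finset.sum_congr rfl fun γ _ => Finset.sum_congr rfl fun σ _ => ?_
      ring
  rw [h1]
  refine Finset.sum_eq_zero fun σ _ => ?_
  rw [← Equiv.sum_comp σ, sub_eq_zero.2, mul_zero]
  exact Finset.sum_congr rfl fun s _ => glAct_muCoeff_term p u σ g G hG x s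

variable {κ : Type*} [DecidableEq κ] (q : κ → ZMod 2)

/-- `μ(σ)` for `W ⊗ U` is the tensor product of those for `W` and for `U`. -/
lemma regroup_muTens_traceTens {n : ℕ} (c : Tens 𝕜 ι n) :
    regroup q u (muTens (glParity p q) u (traceTens 𝕜 p q n c))
      = muTens p (prodParity q u) c := by
  funext x
  rw [regroup, muTens, muTens, Finset.mul_sum]
  refine Finset.sum_congr rfl fun σ _ => ?_
  rw [traceTens_apply, muCoeff_eq, muCoeff_eq, muCoeff_eq]
  have hm : (∀ s, (x (σ s)).2.1 = (x s).2.2) ↔ (∀ s, (x (σ s)).2.1.1 = (x s).2.2.1) ∧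
      ∀ s, (x (σ s)).2.1.2 = (x s).2.2.2 := by
    simp only [← forall_and, Prod.ext_iff]
  simp only [hm]
  by_cases h1 : ∀ s, (x (σ s)).2.1.1 = (x s).2.2.1
  swap
  · simp [h1]
  by_cases h2 : ∀ s, (x (σ s)).2.1.2 = (x s).2.2.2
  swap
  · simp [h2]
  rw [if_pos h1, if_pos h2, if_pos ⟨h1, h2⟩, ← ksgn_sum]
  have key := congrArg (ksgn 𝕜) (muExp_tensor σ (fun s => q (x s).2.2.1) (fun s => q (x s).2.1.1)
    (fun s => u (x s).2.2.2) (fun s => u (x s).2.1.2) (fun s => p (x s).1)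
    (fun s => congrArg q (h1 s)) (fun s => congrArg u (h2 s)))
  rw [ksgn_add, ksgn_add] at key
  rw [mul_assoc, mul_left_comm]
  exact congrArg (c (fun s => (x s).1) σ * ·) key

end invariance

/-! ### Tensors with the extra symmetry -/

section converse

variable {𝕜 : Type*} [Field 𝕜] {ι κ : Type*} (p : ι → ZMod 2) (q : κ → ZMod 2)

/-- A function of finitely many variables that does not change with any one of them is constant. -/
lemma eq_of_update_eq {n : ℕ} {X : Type*} (φ : (Fin n → κ) → X)
    (h : ∀ α j γ, φ (Function.update α j γ) = φ α) (α α' : Fin n → κ) : φ α = φ α' := by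
  have key : ∀ s : Finset (Fin n), φ (s.piecewise α α') = φ α' := fun s => by
    induction s using Finset.induction_on with
    | empty => simp
    | insert j s _ ih => rw [Finset.piecewise_insert, h, ih]
  simpa using key Finset.univ

/-- On distinct even indices of `U`, the function attached to a tensor reads off the coefficient of
a single permutation. -/
lemma regroup_muTens_even [DecidableEq κ] {n N N' : ℕ} (c : Tens 𝕜 (ι × κ × κ) n)
    (x : Fin n → ι × κ × κ) (σ : Equiv.Perm (Fin n)) (r k : Fin n → Fin N)
    (hk : Function.Injective k) (h : ∀ t, r (σ t) = k t) :
    regroup q (stdParity N N') (muTens (glParity p q) (stdParity N N') c)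
      (fun t => ((x t).1, ((x t).2.1, Sum.inl (r t)), ((x t).2.2, Sum.inl (k t)))) = c x σ := by
  have hr : Function.Injective r := by
    have : r = k ∘ σ.symm := by funext t; simp [← h]
    rw [this]; exact hk.comp σ.symm.injective
  simp only [regroup, muTens, muCoeff_eq, stdParity, Sum.elim_inl, add_zero, zero_mul, ksgn_zero,
    Finset.prod_const_one, one_mul]
  rw [Finset.sum_eq_single σ]
  · rw [if_pos (fun t => congrArg Sum.inl (h t))]
    simp [muExp, inv, bil, ksgn_zero]
  · intro τ _ hτ
    rw [if_neg, mul_zero]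
    intro h'
    exact hτ (Equiv.ext fun t => hr ((Sum.inl_injective (h' t)).trans (h t).symm))
  · simp

variable [Fintype κ] [DecidableEq κ]

/-- Invariance under the matrix unit of `gl(W ⊗ U)` that replaces the `j`-th of `n` distinct basis
vectors of `U` by an unused one, and acts as a matrix unit of `W`. The signs do not depend on
the tensor. -/
lemma exists_relation {n : ℕ} (σ : Equiv.Perm (Fin n)) (j : Fin n) (x : Fin n → ι × κ × κ)
    (δ : κ) :
    ∃ ε₁ ε₂ : 𝕜, ε₁ ≠ 0 ∧ ε₂ ≠ 0 ∧ ∀ c : Tens 𝕜 (ι × κ × κ) n,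
      IsGlInvariant p (prodParity q (stdParity (n + 1) (n + 1)))
        (regroup q (stdParity (n + 1) (n + 1))
          (muTens (glParity p q) (stdParity (n + 1) (n + 1)) c)) →
      ε₁ * c (Function.update x (σ j) ((x (σ j)).1, δ, (x (σ j)).2.2)) σ
        = ε₂ * if (x j).2.2 = δ then
            c (Function.update x j ((x j).1, (x j).2.1, (x (σ j)).2.1)) σ else 0 := by
  set u := stdParity (n + 1) (n + 1) with hu
  set Q := prodParity q u with hQ
  set γ := (x (σ j)).2.1 with hγ
  set g := q γ + q δ with hg
  set r : Fin n → Fin (n + 1) := fun t => if t = σ j then Fin.last n else (σ.symm t).castSucc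
    with hr
  set y : Fin n → ι × (κ × (Fin (n + 1) ⊕ Fin (n + 1))) × (κ × (Fin (n + 1) ⊕ Fin (n + 1))) :=
    fun t => ((x t).1, ((x t).2.1, Sum.inl (r t)), ((x t).2.2, Sum.inl t.castSucc)) with hy
  set a₀ : κ × (Fin (n + 1) ⊕ Fin (n + 1)) := (γ, Sum.inl (Fin.last n)) with ha₀
  set b₀ : κ × (Fin (n + 1) ⊕ Fin (n + 1)) := (δ, Sum.inl j.castSucc) with hb₀
  set G : Matrix (κ × (Fin (n + 1) ⊕ Fin (n + 1))) (κ × (Fin (n + 1) ⊕ Fin (n + 1))) 𝕜 :=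
    Matrix.of fun a b => if a = a₀ ∧ b = b₀ then 1 else 0 with hG
  have hGp : ∀ β α, G β α ≠ 0 → Q β + Q α = g := by
    intro β α h
    simp only [hG, Matrix.of_apply, ne_eq, ite_eq_right_iff, one_ne_zero, imp_false,
      not_not] at h
    rw [h.1, h.2]
    simp [hQ, prodParity, hu, stdParity, ha₀, hb₀, hg]
  set e : Fin n → 𝕜 := fun s =>
    ksgn 𝕜 (g * ((∑ t : Fin n, if t < s then glParity p Q (y t) else 0) + p (y s).1)) with he
  refine ⟨e (σ j), e j * ksgn 𝕜 (g * (Q (y j).2.1 + Q a₀)), ksgn_ne_zero _ _,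
    mul_ne_zero (ksgn_ne_zero _ _) (ksgn_ne_zero _ _), fun c hc => ?_⟩
  set d := regroup q u (muTens (glParity p q) u c) with hd
  have h0 : ∑ s, e s * ∑ γ', (G (y s).2.1 γ' * d (Function.update y s ((y s).1, γ', (y s).2.2))
      - ksgn 𝕜 (g * (Q (y s).2.1 + Q γ')) *
        (d (Function.update y s ((y s).1, (y s).2.1, γ')) * G γ' (y s).2.2)) = 0 :=
    congrFun (hc g G hGp) y
  have hrow : ∀ s, (y s).2.1 = a₀ ↔ s = σ j := fun s => by
    by_cases h : s = σ j
    · subst h; simp [hy, hr, ha₀, hγ]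
    · simp [hy, hr, ha₀, h, Fin.castSucc_ne_last]
  have hcol : ∀ s, (y s).2.2 = b₀ ↔ (s = j ∧ (x j).2.2 = δ) := fun s => by
    simp only [hy, hb₀, Prod.mk.injEq, Sum.inl.injEq, Fin.castSucc_inj]
    constructor
    · rintro ⟨h1, rfl⟩; exact ⟨rfl, h1⟩
    · rintro ⟨rfl, h1⟩; exact ⟨h1, rfl⟩
  simp only [Finset.sum_sub_distrib, mul_sub, hG, Matrix.of_apply, hrow, hcol] at h0
  have h1 : ∑ s, e s * ∑ γ', (if s = σ j ∧ γ' = b₀ then (1 : 𝕜) else 0) *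
        d (Function.update y s ((y s).1, γ', (y s).2.2))
      = e (σ j) * d (Function.update y (σ j) ((y (σ j)).1, b₀, (y (σ j)).2.2)) := by
    rw [Finset.sum_eq_single (σ j), Finset.sum_eq_single b₀]
    · simp
    · intro b _ hb; simp [hb]
    · simp
    · intro s _ hs; simp [hs]
    · simp
  have h2 : ∑ s, e s * ∑ γ', ksgn 𝕜 (g * (Q (y s).2.1 + Q γ')) *
        (d (Function.update y s ((y s).1, (y s).2.1, γ')) *
          if γ' = a₀ ∧ s = j ∧ (x j).2.2 = δ then (1 : 𝕜) else 0)
      = e j * (ksgn 𝕜 (g * (Q (y j).2.1 + Q a₀)) *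
        if (x j).2.2 = δ then d (Function.update y j ((y j).1, (y j).2.1, a₀)) else 0) := by
    rw [Finset.sum_eq_single j, Finset.sum_eq_single a₀]
    · simp
    · intro b _ hb; simp [hb]
    · simp
    · intro s _ hs; simp [hs]
    · simp
  rw [h1, h2] at h0
  have hd1 : d (Function.update y (σ j) ((y (σ j)).1, b₀, (y (σ j)).2.2))
      = c (Function.update x (σ j) ((x (σ j)).1, δ, (x (σ j)).2.2)) σ := by
    rw [← regroup_muTens_even p q (N := n + 1) (N' := n + 1) c _ σ
      (fun t => (σ.symm t).castSucc) Fin.castSucc (Fin.castSucc_injective n) (fun t => by simp)]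
    rw [hd]
    congr 1
    funext t
    by_cases h : t = σ j
    · subst h; simp [hy, hb₀]
    · simp [hy, hr, h]
  have hd2 : d (Function.update y j ((y j).1, (y j).2.1, a₀))
      = c (Function.update x j ((x j).1, (x j).2.1, γ)) σ := by
    rw [← regroup_muTens_even p q (N := n + 1) (N' := n + 1) c _ σ
      r (fun t => if t = j then Fin.last n else t.castSucc) (fun t t' h => by
        by_cases ht : t = j <;> by_cases ht' : t' = j
        · rw [ht, ht']
        · simp [ht, ht', (Fin.castSucc_ne_last _).symm] at h
        · simp [ht, ht', Fin.castSucc_ne_last] at h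
        · simpa [ht, ht'] using h) (fun t => by simp [hr])]
    rw [hd]
    congr 1
    funext t
    by_cases h : t = j
    · subst h; simp [hy, ha₀]
    · simp [hy, h]
  rw [hd1, hd2] at h0
  rw [mul_assoc]
  exact sub_eq_zero.1 h0

/-- A tensor whose function is invariant under `gl(W ⊗ U)` is a linear combination of the
permutations of tensors: it commutes with matrix units of `W` acting on a single factor. -/
lemma exists_traceTens_eq [Nonempty κ] {n : ℕ} (c : Tens 𝕜 (ι × κ × κ) n)
    (hc : IsGlInvariant p (prodParity q (stdParity (n + 1) (n + 1)))
        (regroup q (stdParity (n + 1) (n + 1))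
          (muTens (glParity p q) (stdParity (n + 1) (n + 1)) c))) :
    ∃ c₀ : Tens 𝕜 ι n, traceTens 𝕜 p q n c₀ = c := by
  obtain ⟨β₀⟩ := ‹Nonempty κ›
  -- `μ(σ)` itself satisfies the relations, which compares its signs with those of `c`
  have hm : IsGlInvariant p (prodParity q (stdParity (n + 1) (n + 1)))
        (regroup q (stdParity (n + 1) (n + 1)) (muTens (glParity p q)
          (stdParity (n + 1) (n + 1)) (traceTens 𝕜 p q n fun _ _ => 1))) := by
    rw [regroup_muTens_traceTens]; exact isGlInvariant_muTens _ _ _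
  set Y : (Fin n → ι) → Equiv.Perm (Fin n) → (Fin n → κ) → Fin n → ι × κ × κ :=
    fun i σ α t => (i t, α (σ.symm t), α t) with hY
  have hmY : ∀ i σ α, muCoeff 𝕜 p q σ (Y i σ α) ≠ 0 := fun i σ α => by
    rw [muCoeff_eq, if_pos (fun t => by simp [hY])]
    exact ksgn_ne_zero _ _
  have hconst : ∀ i σ α α', c (Y i σ α) σ / muCoeff 𝕜 p q σ (Y i σ α)
      = c (Y i σ α') σ / muCoeff 𝕜 p q σ (Y i σ α') := by
    intro i σ
    refine eq_of_update_eq (fun α => c (Y i σ α) σ / muCoeff 𝕜 p q σ (Y i σ α)) fun α j γ => ?_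
    set x : Fin n → ι × κ × κ := fun t => (i t, Function.update α j γ (σ.symm t), α t) with hx
    obtain ⟨ε₁, ε₂, h1, h2, h⟩ := exists_relation (𝕜 := 𝕜) p q σ j x (α j)
    have e1 : Function.update x (σ j) ((x (σ j)).1, α j, (x (σ j)).2.2) = Y i σ α := by
      funext t
      by_cases ht : t = σ j
      · subst ht; simp [hx, hY]
      · have : σ.symm t ≠ j := fun h' => ht (by rw [← h']; simp)
        simp [hx, hY, ht, this]
    have e2 : Function.update x j ((x j).1, (x j).2.1, (x (σ j)).2.1)
        = Y i σ (Function.update α j γ) := by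
      funext t
      by_cases ht : t = j
      · subst ht; simp [hx, hY]
      · simp [hx, hY, ht]
    have r1 := h c hc
    have r2 := h _ hm
    rw [e1, e2, if_pos rfl] at r1 r2
    rw [traceTens_apply, traceTens_apply, one_mul, one_mul] at r2
    rw [div_eq_div_iff (hmY _ _ _) (hmY _ _ _)]
    apply mul_left_cancel₀ (mul_ne_zero h1 h2)
    linear_combination (c (Y i σ (Function.update α j γ)) σ * ε₂) * r2
      - ε₂ * muCoeff 𝕜 p q σ (Y i σ (Function.update α j γ)) * r1
  refine ⟨fun i σ => c (Y i σ fun _ => β₀) σ / muCoeff 𝕜 p q σ (Y i σ fun _ => β₀), ?_⟩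
  funext x σ
  rw [traceTens_apply]
  by_cases hx : ∀ t, (x (σ t)).2.1 = (x t).2.2
  · have e : x = Y (fun t => (x t).1) σ (fun t => (x t).2.2) := by
      funext t
      have h' := hx (σ.symm t)
      rw [Equiv.apply_symm_apply] at h'
      simp [hY, ← h']
    have h := hconst (fun t => (x t).1) σ (fun _ => β₀) (fun t => (x t).2.2)
    rw [← e] at h
    have hne : muCoeff 𝕜 p q σ x ≠ 0 := by
      rw [muCoeff_eq, if_pos hx]; exact ksgn_ne_zero _ _
    exact (congrArg (· * muCoeff 𝕜 p q σ x) h).trans (div_mul_cancel₀ _ hne)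
  · rw [muCoeff_eq 𝕜 p q σ x, if_neg hx, mul_zero]
    push Not at hx
    obtain ⟨j, hj⟩ := hx
    obtain ⟨ε₁, ε₂, h1, h2, h⟩ := exists_relation (𝕜 := 𝕜) p q σ j x (x (σ j)).2.1
    have r := h c hc
    rw [if_neg hj.symm, mul_zero] at r
    have e : Function.update x (σ j) ((x (σ j)).1, (x (σ j)).2.1, (x (σ j)).2.2) = x :=
      Function.update_eq_self _ _
    rw [e] at r
    exact ((mul_eq_zero.1 r).resolve_left h1).symm

/-- The image of the trace map has the extra symmetry: for it, the function on
`gl(U) ⊗ Π(V ⊗ End W)` is the one that the preimage defines on `gl(W ⊗ U) ⊗ ΠV`. -/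
lemma hasExtraSymmetry_traceMap (f : F 𝕜 p) : HasExtraSymmetry (traceMap 𝕜 p q f) := by
  intro N n
  have h : muF (stdParity N N) (traceMap 𝕜 p q f n)
      = muTens (glParity p q) (stdParity N N) (traceTens 𝕜 p q n (f n)) := by
    rw [← coe_traceMap_apply]; rfl
  rw [h, regroup_muTens_traceTens]
  exact isGlInvariant_muTens _ _ _

lemma HasExtraSymmetry.exists_traceMap_eq [CharZero 𝕜] [Nonempty κ]
    {f : F 𝕜 (glParity p q)} (hf : HasExtraSymmetry f) : ∃ f₀, traceMap 𝕜 p q f₀ = f := by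
  have h : ∀ n, f n ∈ LinearMap.range (traceFn (𝕜 := 𝕜) p q n) := fun n => by
    obtain ⟨c₀, hc₀⟩ := exists_traceTens_eq p q (f n : Tens 𝕜 _ n) (hf (n + 1) n)
    refine ⟨avg 𝕜 p n c₀, ?_⟩
    rw [traceFn_avg, hc₀, avg_of_mem]
  have h' : f ∈ LinearMap.range (traceMap 𝕜 p q) := by
    rw [traceMap, DirectSum.range_lmap]
    exact fun n _ => h n
  exact h'

end converse

section empty

variable {𝕜 : Type*} [Field 𝕜] {ι κ : Type*} {p : ι → ZMod 2}

/-- Constants are solutions, since `Delta` and the bracket vanish on them. -/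
lemma isSolution_ofFn_zero [Fintype ι] (l : OddScalarProduct 𝕜 p) (c : ℕ → Fn 𝕜 p 0) :
    IsSolution l (fun a => ofFn 𝕜 p 0 (c a)) := by
  have hbr : ∀ a b : Fn 𝕜 p 0, bracket l (ofFn 𝕜 p 0 a) (ofFn 𝕜 p 0 b) = 0 := fun a b => by
    have h := Delta_ofFn_zero l
    rw [bracket, parityOp_ofFn, mul_ofFn, h, h, h, map_zero, map_zero, LinearMap.zero_apply,
      sub_zero]
    exact sub_self _
  refine ⟨fun a n i σ h => ?_, fun m => ?_⟩
  · rcases n with _ | n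
    · simp
    · refine absurd ?_ h
      have : ofFn 𝕜 p 0 (c a) (n + 1) = 0 := DirectSum.of_eq_of_ne _ _ _ (Nat.succ_ne_zero n)
      rw [this]; rfl
  · have : hbarDelta l (fun a => ofFn 𝕜 p 0 (c a)) m = 0 := by
      cases m with
      | zero => rfl
      | succ m => exact Delta_ofFn_zero l _
    simp [this, hbr]

lemma exists_traceMap_ofFn_zero [CharZero 𝕜] [DecidableEq κ] [IsEmpty κ] (q : κ → ZMod 2)
    (f : F 𝕜 (glParity p q)) : ∃ c : Fn 𝕜 p 0, traceMap 𝕜 p q (ofFn 𝕜 p 0 c) = f := by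
  refine ⟨avg 𝕜 p 0 fun _ σ => (f 0).1 Fin.elim0 σ, ?_⟩
  rw [traceMap_avg]
  refine DFinsupp.ext fun n => ?_
  rcases n with _ | n
  · rw [← avg_of_mem 𝕜 _ (f 0)]
    refine (ofFn_apply_self 𝕜 _ _).trans (congrArg _ ?_)
    funext x σ
    rw [traceTens_apply, muCoeff_eq, if_pos (fun s => s.elim0), Subsingleton.elim Fin.elim0 x]
    simp [muExp, inv, bil, ksgn_zero, avg_of_mem]
  · refine Subtype.ext ?_
    funext x
    exact isEmptyElim (x 0).2.1

end empty

end NCBV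

theorem mainTheorem4 {𝕜 : Type*} [Field 𝕜] [CharZero 𝕜] {ι : Type*} [Fintype ι] [DecidableEq ι]
    (p : ι → ZMod 2) (l : NCBV.OddScalarProduct 𝕜 p) (k k' : ℕ) :
    ∃ M : NCBV.F 𝕜 p →ₗ[𝕜] NCBV.F 𝕜 (NCBV.glParity p (NCBV.stdParity k k')),
      (NCBV.IsTraceMap M ∧ ∀ M', NCBV.IsTraceMap M' → M' = M) ∧
      (∀ S : ℕ → NCBV.F 𝕜 p, NCBV.IsSolution l S →
        NCBV.IsSolution (l.tensorGl (NCBV.stdParity k k')) (fun a => M (S a))) ∧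
      (∀ T : ℕ → NCBV.F 𝕜 (NCBV.glParity p (NCBV.stdParity k k')),
        NCBV.IsSolution (l.tensorGl (NCBV.stdParity k k')) T →
          ((∃ S : ℕ → NCBV.F 𝕜 p, NCBV.IsSolution l S ∧ ∀ a, M (S a) = T a) ↔
            ∀ a, NCBV.HasExtraSymmetry (T a))) := by
  set q := NCBV.stdParity k k'
  have htr := NCBV.isTraceMap_traceMap 𝕜 p q
  refine ⟨NCBV.traceMap 𝕜 p q, ⟨htr, fun M' hM' => hM'.eq p q htr⟩,
    fun S hS => NCBV.isSolution_traceMap q l hS, fun T hT => ⟨?_, fun hsym => ?_⟩⟩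
  · rintro ⟨S, -, hS⟩ a
    rw [← hS a]
    exact NCBV.hasExtraSymmetry_traceMap p q (S a)
  · rcases isEmpty_or_nonempty (Fin k ⊕ Fin k') with hκ | hκ
    -- for `W = 0` the trace map is not injective, but constants are solutions
    · choose c hc using fun a => NCBV.exists_traceMap_ofFn_zero q (T a)
      exact ⟨_, NCBV.isSolution_ofFn_zero l c, hc⟩
    · choose S hS using fun a => (hsym a).exists_traceMap_eq
      refine ⟨S, NCBV.isSolution_of_traceMap q l ?_, hS⟩
      simpa only [hS] using hT
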